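/- Let $\triangle_H=\{(z,w)\in\mathbb C^2:|z|<|w|<1\}$ be the Hartogs triangle and let $H^2(\triangle_H)$ be the Hilbert space of all holomorphic functions $f$ on $\triangle_H$ with $$\|f\|^2=\sup_{0<s,t<1}\frac1{4\pi^2}\int_0^{2\pi}\!\!\int_0^{2\pi}\bigl|f(st e^{i\theta},te^{i\gamma})\bigr|^2\,st^2\,d\theta\,d\gamma<\infty .$$ Let $M_z,M_w$ be the operators of multiplication by the coordinates $z,w$ on $H^2(\triangle_H)$, and let $H^2_+(\triangle_H)$ be the subspace of all $f\in H^2(\triangle_H)$ that have an expansion $f(z,w)=\sum_{i,j\ge 0}a_{ij}z^iw^j$ on $\triangle_H$. A submodule of $H^2(\triangle_H)$ is a closed subspace $\mathcal S$ invariant under $M_z$ and $M_w$; put $S_z=M_z|_{\mathcal S}$ and $S_w=M_w|_{\mathcal S}$, and call $\mathcal S$ doubly commuting if $S_z^*S_w-S_wS_z^*=0$ on $\mathcal S$. A function $q$ on $\triangle_H$ is called unimodular if it has a boundary function on $\mathbb T^2$ (the limit in $L^2(\mathbb T^2)$ of $(\zeta_1,\zeta_2)\mapsto q(st\zeta_1,t\zeta_2)$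 as $s,t\to1^-$) and this boundary function has modulus $1$ almost everywhere on $\mathbb T^2$. **Theorem.** Let $\mathcal S\ne\{0\}$ be a submodule of $H^2(\triangle_H)$. Then $\mathcal S$ is doubly commuting if and only if $\mathcal S=q\,H^2_+(\triangle_H)=\{qg: g\in H^2_+(\triangle_H)\}$ for some unimodular function $q$ on $\triangle_H$. -/

import Mathlib

/-!
# The Hardy space of the Hartogs triangle

`HardySpace` is the Hilbert space of holomorphic functions on the Hartogs triangle with bounded
integral means. Most of what follows is the proof that the limits of the integral means define
a complete inner product on it: the coefficients of the Laurent expansion embed it isometrically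
in `ℓ²`. Submodules, double commutativity, the subspace of power series, and boundary functions
are defined at the end.
-/

noncomputable section

open MeasureTheory Filter Topology Set
open scoped ComplexConjugate ENNReal

namespace Hartogs

/-! ### The triangle, the torus and the integral means -/

/-- The Hartogs triangle `{(z, w) : |z| < |w| < 1}`. -/
def triangle : Set (ℂ × ℂ) := {p | ‖p.1‖ < ‖p.2‖ ∧ ‖p.2‖ < 1}

/-- The torus `𝕋²`, which is the distinguished boundary of the triangle; `x` stands for the point
`(exp (2πi x₀), exp (2πi x₁))`. -/
abbrev Torus : Type := UnitAddTorus (Fin 2)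

/-- The normalized Lebesgue measure `dθ dγ / 4π²` on `𝕋²`. -/
abbrev torusMeasure : Measure Torus := Measure.pi fun _ => AddCircle.haarAddCircle

/-- Extension by zero of a function on the triangle to `ℂ²`. -/
def extZero (f : triangle → ℂ) : ℂ × ℂ → ℂ := Function.extend Subtype.val f 0

/-- Holomorphic functions on the triangle. -/
def IsHolomorphic (f : triangle → ℂ) : Prop := DifferentiableOn ℂ (extZero f) triangle

/-- The dilate `(e^{iθ}, e^{iγ}) ↦ f (s t e^{iθ}, t e^{iγ})`, for `0 < s, t < 1`. -/
def slice (f : triangle → ℂ) (s t : ℝ) (x : Torus) : ℂ :=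
  extZero f ((s : ℂ) * t * (x 0).toCircle, (t : ℂ) * (x 1).toCircle)

/-- `(1 / 4π²) ∫∫ |f (s t e^{iθ}, t e^{iγ})|² s t² dθ dγ`. -/
def mean (f : triangle → ℂ) (s t : ℝ) : ℝ :=
  ∫ x, ‖slice f s t x‖ ^ 2 * (s * t ^ 2) ∂torusMeasure

lemma extZero_of_mem (f : triangle → ℂ) {p : ℂ × ℂ} (hp : p ∈ triangle) :
    extZero f p = f ⟨p, hp⟩ :=
  Subtype.val_injective.extend_apply f 0 ⟨p, hp⟩

lemma extZero_add (f g : triangle → ℂ) : extZero (f + g) = extZero f + extZero g := by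
  ext p
  by_cases hp : p ∈ triangle
  · simp [extZero_of_mem _ hp]
  · have : ¬ ∃ a : triangle, a.1 = p := by rintro ⟨a, rfl⟩; exact hp a.2
    simp [extZero, Function.extend_apply' _ _ _ this]

lemma extZero_smul (c : ℂ) (f : triangle → ℂ) : extZero (c • f) = c • extZero f := by
  ext p
  by_cases hp : p ∈ triangle
  · simp [extZero_of_mem _ hp]
  · have : ¬ ∃ a : triangle, a.1 = p := by rintro ⟨a, rfl⟩; exact hp a.2
    simp [extZero, Function.extend_apply' _ _ _ this]

lemma extZero_zero : extZero 0 = 0 := by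
  simpa using extZero_smul 0 0

lemma slice_add (f g : triangle → ℂ) (s t : ℝ) : slice (f + g) s t = slice f s t + slice g s t := by
  ext x; simp [slice, extZero_add]

lemma slice_smul (c : ℂ) (f : triangle → ℂ) (s t : ℝ) : slice (c • f) s t = c • slice f s t := by
  ext x; simp [slice, extZero_smul]

lemma mem_triangle {s t : ℝ} (hs : s ∈ Ioo (0 : ℝ) 1) (ht : t ∈ Ioo (0 : ℝ) 1) (a b : Circle) :
    ((s : ℂ) * t * a, (t : ℂ) * b) ∈ triangle := by
  simp only [triangle, mem_ofPred_eq, norm_mul, Complex.norm_real, Circle.norm_coe, mul_one,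
    Real.norm_eq_abs, abs_of_pos hs.1, abs_of_pos ht.1]
  exact ⟨by nlinarith [hs.2, ht.1], ht.2⟩

lemma slice_apply (f : triangle → ℂ) {s t : ℝ} (hs : s ∈ Ioo (0 : ℝ) 1) (ht : t ∈ Ioo (0 : ℝ) 1)
    (x : Torus) : slice f s t x = f ⟨_, mem_triangle hs ht (x 0).toCircle (x 1).toCircle⟩ :=
  extZero_of_mem f _

lemma continuous_slice {f : triangle → ℂ} (hf : IsHolomorphic f) {s t : ℝ}
    (hs : s ∈ Ioo (0 : ℝ) 1) (ht : t ∈ Ioo (0 : ℝ) 1) : Continuous (slice f s t) := by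
  have h : Continuous fun x : Torus =>
      (((s : ℂ) * t * (x 0).toCircle, (t : ℂ) * (x 1).toCircle) : ℂ × ℂ) := by
    have h0 := AddCircle.continuous_toCircle (T := 1)
    fun_prop
  exact hf.continuousOn.comp_continuous h fun x => mem_triangle hs ht _ _

lemma integrable_of_continuous {E : Type*} [NormedAddCommGroup E] {F : Torus → E} (hF : Continuous F) :
    Integrable F torusMeasure :=
  hF.integrable_of_hasCompactSupport (HasCompactSupport.of_compactSpace F)

lemma mean_add_le {f g : triangle → ℂ} (hf : IsHolomorphic f) (hg : IsHolomorphic g) {s t : ℝ}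
    (hs : s ∈ Ioo (0 : ℝ) 1) (ht : t ∈ Ioo (0 : ℝ) 1) :
    mean (f + g) s t ≤ 2 * mean f s t + 2 * mean g s t := by
  have cf := continuous_slice hf hs ht
  have cg := continuous_slice hg hs ht
  simp only [mean, slice_add]
  rw [← integral_const_mul, ← integral_const_mul, ← integral_add]
  · refine integral_mono ?_ ?_ fun x => ?_
    · exact integrable_of_continuous (by fun_prop)
    · exact integrable_of_continuous (by fun_prop)
    · have h1 := norm_add_le (slice f s t x) (slice g s t x)
      have h2 : 0 ≤ s * t ^ 2 := by have := hs.1; positivity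
      have h3 : ‖slice f s t x + slice g s t x‖ ^ 2 ≤
          2 * ‖slice f s t x‖ ^ 2 + 2 * ‖slice g s t x‖ ^ 2 := by
        nlinarith [norm_nonneg (slice f s t x + slice g s t x),
          sq_nonneg (‖slice f s t x‖ - ‖slice g s t x‖)]
      simp only [Pi.add_apply]
      nlinarith
  · exact integrable_of_continuous (by fun_prop)
  · exact integrable_of_continuous (by fun_prop)

lemma mean_smul (c : ℂ) (f : triangle → ℂ) (s t : ℝ) : mean (c • f) s t = ‖c‖ ^ 2 * mean f s t := by
  simp only [mean, slice_smul]
  rw [← integral_const_mul]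
  congr 1; ext x
  simp [mul_pow]; ring

/-- The holomorphic functions on the triangle whose integral means are bounded for `0 < s, t < 1`. -/
def hardySubspace : Submodule ℂ (triangle → ℂ) where
  carrier := {f | IsHolomorphic f ∧
    ∃ C : ℝ, ∀ s ∈ Ioo (0 : ℝ) 1, ∀ t ∈ Ioo (0 : ℝ) 1, mean f s t ≤ C}
  add_mem' := by
    rintro f g ⟨hf, C, hC⟩ ⟨hg, D, hD⟩
    refine ⟨?_, 2 * C + 2 * D, fun s hs t ht => ?_⟩
    · rw [IsHolomorphic, extZero_add]; exact hf.add hg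
    · linarith [mean_add_le hf hg hs ht, hC s hs t ht, hD s hs t ht]
  zero_mem' := by
    refine ⟨?_, 0, fun s hs t ht => ?_⟩
    · rw [IsHolomorphic, extZero_zero]; exact differentiableOn_const 0
    · simp [mean, slice, extZero_zero]
  smul_mem' := by
    rintro c f ⟨hf, C, hC⟩
    refine ⟨?_, ‖c‖ ^ 2 * C, fun s hs t ht => ?_⟩
    · rw [IsHolomorphic, extZero_smul]; exact hf.const_smul c
    · rw [mean_smul]; exact mul_le_mul_of_nonneg_left (hC s hs t ht) (by positivity)

/-- The Hardy space `H²` of the triangle. A type synonym, since the topology is that of the Hardy norm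
and not the one of pointwise convergence. -/
def HardySpace : Type := hardySubspace

instance : AddCommGroup HardySpace := inferInstanceAs (AddCommGroup hardySubspace)
instance : Module ℂ HardySpace := inferInstanceAs (Module ℂ hardySubspace)
instance : FunLike HardySpace triangle ℂ where
  coe f := f.1
  coe_injective _ _ h := Subtype.ext h

lemma exists_toCircle {v : ℂ} (hv : v ≠ 0) : ∃ x : UnitAddCircle, v = ‖v‖ * (x.toCircle : ℂ) := by
  have hn : (‖v‖ : ℂ) ≠ 0 := by simpa using hv
  have hu : v / ‖v‖ ∈ Submonoid.unitSphere ℂ := by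
    simp [Submonoid.unitSphere, hv]
  obtain ⟨x, hx⟩ := (AddCircle.homeomorphCircle (one_ne_zero (α := ℝ))).surjective ⟨_, hu⟩
  refine ⟨x, ?_⟩
  rw [AddCircle.homeomorphCircle_apply] at hx
  rw [hx]
  field_simp

lemma HardySpace.coe_mem (f : HardySpace) : (f : triangle → ℂ) ∈ hardySubspace := f.2

/-! ### Laurent coefficients -/

lemma annulus_coeff {h : ℂ → ℂ} {R : ℝ} (hh : ∀ z, 0 < ‖z‖ → ‖z‖ < R → DifferentiableAt ℂ h z)
    (n : ℤ) {r₁ r₂ : ℝ} (h1 : 0 < r₁) (h12 : r₁ ≤ r₂) (h2 : r₂ < R) :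
    (r₁ : ℂ) ^ (-n) * ∫ x, fourier (-n) x * h (r₁ * (AddCircle.toCircle x : ℂ))
        ∂(AddCircle.haarAddCircle (T := 1)) =
    (r₂ : ℂ) ^ (-n) * ∫ x, fourier (-n) x * h (r₂ * (AddCircle.toCircle x : ℂ))
        ∂(AddCircle.haarAddCircle (T := 1)) := by
  have key : ∀ r : ℝ, 0 < r →
      (∮ z in C(0, r), (z - 0)⁻¹ • (z ^ (-n) * h z)) = 2 * Real.pi * Complex.I *
      ((r : ℂ) ^ (-n) * ∫ x, fourier (-n) x * h (r * (AddCircle.toCircle x : ℂ))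
        ∂(AddCircle.haarAddCircle (T := 1))) := by
    intro r hr
    have hv : (AddCircle.haarAddCircle (T := 1)) = (volume : Measure (AddCircle (1 : ℝ))) := by
      simp [AddCircle.volume_eq_smul_haarAddCircle]
    rw [hv, ← AddCircle.intervalIntegral_preimage 1 0, ← intervalIntegral.integral_const_mul,
      ← intervalIntegral.integral_const_mul, circleIntegral]
    have e1 := intervalIntegral.smul_integral_comp_mul_left (a := 0) (b := 1)
      (fun θ : ℝ => deriv (circleMap 0 r) θ • (circleMap 0 r θ - 0)⁻¹ •
        (circleMap 0 r θ ^ (-n) * h (circleMap 0 r θ))) (2 * Real.pi)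
    simp only [mul_zero, mul_one] at e1
    rw [← e1, ← intervalIntegral.integral_smul]
    simp only [zero_add]
    congr 1; ext θ
    have c1 : circleMap 0 r (2 * Real.pi * θ) = r * ((AddCircle.toCircle (θ : AddCircle (1:ℝ))) : ℂ) := by
      rw [AddCircle.toCircle_apply_mk]; simp [circleMap]
    have c2 : (fourier (-n) (θ : AddCircle (1:ℝ)) : ℂ) =
        ((AddCircle.toCircle (θ : AddCircle (1:ℝ))) : ℂ) ^ (-n) := by
      rw [fourier_apply, AddCircle.toCircle_zsmul]; simp
    have c3 : (r : ℂ) * ((AddCircle.toCircle (θ : AddCircle (1:ℝ))) : ℂ) ≠ 0 := by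
      simp [hr.ne']
    rw [deriv_circleMap, c1, c2]
    simp only [sub_zero, smul_eq_mul, Complex.real_smul]
    have hr' : (r : ℂ) ≠ 0 := by simp [hr.ne']
    rw [mul_zpow]
    push_cast
    field_simp
  have hd : ∀ z, r₁ ≤ ‖z‖ → ‖z‖ ≤ r₂ → DifferentiableAt ℂ (fun z => z ^ (-n) * h z) z := by
    intro z hz1 hz2
    have hz : z ≠ 0 := by rintro rfl; simp at hz1; linarith
    exact (differentiableAt_zpow.2 (Or.inl hz)).mul (hh z (by simpa using hz) (by linarith))
  have := Complex.circleIntegral_sub_center_inv_smul_eq_of_differentiable_on_annulus_off_countable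
    (c := 0) h1 h12 (f := fun z => z ^ (-n) * h z) countable_empty
    (fun z hz => (hd z (by simpa using hz.2) (by simpa using hz.1)).continuousAt.continuousWithinAt)
    (fun z hz => hd z (by simpa using le_of_lt (by simpa using hz.1.2))
      (le_of_lt (by simpa using hz.1.1)))
  rw [key r₁ h1, key r₂ (h1.trans_le h12)] at this
  exact (mul_left_cancel₀ (by simp [Real.pi_ne_zero]) this).symm

lemma fourierCoeff_eq (F : Torus → ℂ) (α : Fin 2 → ℤ) :
    UnitAddTorus.mFourierCoeff F α =
      ∫ x, fourier (-α 0) (x 0) * fourier (-α 1) (x 1) * F x ∂torusMeasure := by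
  change ∫ x, UnitAddTorus.mFourier (-α) x • F x ∂torusMeasure = _
  simp [UnitAddTorus.mFourier]

lemma integral_torus {F : Torus → ℂ} (hF : Continuous F) :
    ∫ x, F x ∂torusMeasure = ∫ b, ∫ a, F ![a, b]
      ∂(AddCircle.haarAddCircle (T := 1)) ∂(AddCircle.haarAddCircle (T := 1)) := by
  have h := (measurePreserving_finTwoArrow (AddCircle.haarAddCircle (T := 1))).symm
  rw [← h.integral_comp (MeasurableEquiv.measurableEmbedding _), integral_prod_symm]
  · rfl
  · have : Continuous fun p : UnitAddCircle × UnitAddCircle => F ![p.1, p.2] :=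
      hF.comp (by fun_prop)
    exact this.integrable_of_hasCompactSupport (HasCompactSupport.of_compactSpace _)

lemma integral_torus_twist {F : Torus → ℂ} (hF : Continuous F) :
    ∫ x, F x ∂torusMeasure = ∫ a, ∫ b, F ![a + b, b]
      ∂(AddCircle.haarAddCircle (T := 1)) ∂(AddCircle.haarAddCircle (T := 1)) := by
  have h1 : Continuous fun p : UnitAddCircle × UnitAddCircle => F ![p.1 + p.2, p.2] :=
    hF.comp (by fun_prop)
  rw [integral_torus hF, integral_integral_swap (f := fun a b => F ![a + b, b])
    (h1.integrable_of_hasCompactSupport (HasCompactSupport.of_compactSpace _))]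
  congr 1; ext b
  exact (integral_add_right_eq_self (fun a => F ![a, b]) b).symm

lemma continuous_coeff_integrand {f : triangle → ℂ} (hf : IsHolomorphic f) {s t : ℝ}
    (hs : s ∈ Ioo (0 : ℝ) 1) (ht : t ∈ Ioo (0 : ℝ) 1) (m n : ℤ) :
    Continuous fun x : Torus => fourier m (x 0) * fourier n (x 1) * slice f s t x := by
  have := continuous_slice hf hs ht
  fun_prop

lemma isOpen_triangle : IsOpen triangle :=
  (isOpen_lt (continuous_norm.comp continuous_fst) (continuous_norm.comp continuous_snd)).inter
    (isOpen_lt (continuous_norm.comp continuous_snd) continuous_const)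

lemma coeff_indep_left {f : triangle → ℂ} (hf : IsHolomorphic f) (α : Fin 2 → ℤ) {s₁ s₂ t : ℝ}
    (hs₁ : s₁ ∈ Ioo (0 : ℝ) 1) (hs₂ : s₂ ∈ Ioo (0 : ℝ) 1) (h12 : s₁ ≤ s₂)
    (ht : t ∈ Ioo (0 : ℝ) 1) :
    (s₁ : ℂ) ^ (-α 0) * UnitAddTorus.mFourierCoeff (slice f s₁ t) α =
      (s₂ : ℂ) ^ (-α 0) * UnitAddTorus.mFourierCoeff (slice f s₂ t) α := by
  have ht0 : (t : ℂ) ≠ 0 := by simp [ht.1.ne']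
  rw [fourierCoeff_eq, fourierCoeff_eq, integral_torus (continuous_coeff_integrand hf hs₁ ht _ _),
    integral_torus (continuous_coeff_integrand hf hs₂ ht _ _), ← integral_const_mul,
    ← integral_const_mul]
  congr 1; ext b
  have hd : ∀ z : ℂ, 0 < ‖z‖ → ‖z‖ < 1 →
      DifferentiableAt ℂ (fun z => extZero f (z * t, t * b.toCircle)) z := by
    intro z _ hz
    have hm : (z * t, (t : ℂ) * b.toCircle) ∈ triangle := by
      simp only [triangle, mem_ofPred_eq, norm_mul, Complex.norm_real, Circle.norm_coe, mul_one,
        Real.norm_eq_abs, abs_of_pos ht.1]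
      exact ⟨by nlinarith [ht.1], ht.2⟩
    exact (hf.differentiableAt (isOpen_triangle.mem_nhds hm)).comp (f := fun z : ℂ =>
      (z * t, (t : ℂ) * b.toCircle)) z (by fun_prop)
  have := annulus_coeff hd (α 0) hs₁.1 h12 hs₂.2
  have e : ∀ s : ℝ, ∀ a : UnitAddCircle, fourier (-α 0) ((![a, b] : Torus) 0) *
      fourier (-α 1) ((![a, b] : Torus) 1) * slice f s t ![a, b] =
      fourier (-α 1) b * (fourier (-α 0) a * extZero f (s * a.toCircle * t, t * b.toCircle)) := by
    intro s a
    simp only [slice, Matrix.cons_val_zero, Matrix.cons_val_one]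
    rw [mul_right_comm (s : ℂ)]; ring
  simp only [e, integral_const_mul]
  rw [mul_left_comm, this, mul_left_comm]

lemma coeff_indep_right {f : triangle → ℂ} (hf : IsHolomorphic f) (α : Fin 2 → ℤ) {s t₁ t₂ : ℝ}
    (hs : s ∈ Ioo (0 : ℝ) 1) (ht₁ : t₁ ∈ Ioo (0 : ℝ) 1) (ht₂ : t₂ ∈ Ioo (0 : ℝ) 1)
    (h12 : t₁ ≤ t₂) :
    (t₁ : ℂ) ^ (-(α 0 + α 1)) * UnitAddTorus.mFourierCoeff (slice f s t₁) α =
      (t₂ : ℂ) ^ (-(α 0 + α 1)) * UnitAddTorus.mFourierCoeff (slice f s t₂) α := by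
  rw [fourierCoeff_eq, fourierCoeff_eq,
    integral_torus_twist (continuous_coeff_integrand hf hs ht₁ _ _),
    integral_torus_twist (continuous_coeff_integrand hf hs ht₂ _ _), ← integral_const_mul,
    ← integral_const_mul]
  congr 1; ext a
  have hd : ∀ w : ℂ, 0 < ‖w‖ → ‖w‖ < 1 →
      DifferentiableAt ℂ (fun w => extZero f (s * a.toCircle * w, w)) w := by
    intro w hw hw1
    have hm : ((s : ℂ) * a.toCircle * w, w) ∈ triangle := by
      simp only [triangle, mem_ofPred_eq, norm_mul, Complex.norm_real, Circle.norm_coe, mul_one,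
        Real.norm_eq_abs, abs_of_pos hs.1]
      exact ⟨by nlinarith [hs.2], hw1⟩
    exact (hf.differentiableAt (isOpen_triangle.mem_nhds hm)).comp (f := fun w : ℂ =>
      ((s : ℂ) * a.toCircle * w, w)) w (by fun_prop)
  have := annulus_coeff hd (α 0 + α 1) ht₁.1 h12 ht₂.2
  have e : ∀ t : ℝ, ∀ b : UnitAddCircle, fourier (-α 0) ((![a + b, b] : Torus) 0) *
      fourier (-α 1) ((![a + b, b] : Torus) 1) * slice f s t ![a + b, b] =
      fourier (-α 0) a * (fourier (-(α 0 + α 1)) b *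
        extZero f (s * a.toCircle * (t * b.toCircle), t * b.toCircle)) := by
    intro t b
    have e1 : (fourier (-α 0) (a + b) : ℂ) = fourier (-α 0) a * fourier (-α 0) b := by
      simp [fourier_apply, AddCircle.toCircle_add, smul_add]
    have e2 : (fourier (-(α 0 + α 1)) b : ℂ) = fourier (-α 0) b * fourier (-α 1) b := by
      rw [neg_add, fourier_add]
    have e3 : (s : ℂ) * a.toCircle * (t * b.toCircle) = s * t * (a + b).toCircle := by
      rw [AddCircle.toCircle_add]; push_cast; ring
    rw [e2, e3]
    simp only [slice, Matrix.cons_val_zero, Matrix.cons_val_one, e1]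
    ring
  simp only [e, integral_const_mul]
  rw [mul_left_comm, this, mul_left_comm]

/-- The coefficient of `z ^ α₀ * w ^ α₁` in the Laurent expansion of `f`. -/
def coeff (f : triangle → ℂ) (α : Fin 2 → ℤ) : ℂ :=
  ((2⁻¹ : ℝ) : ℂ) ^ (-α 0) * ((2⁻¹ : ℝ) : ℂ) ^ (-(α 0 + α 1)) *
    UnitAddTorus.mFourierCoeff (slice f 2⁻¹ 2⁻¹) α

lemma mFourierCoeff_slice {f : triangle → ℂ} (hf : IsHolomorphic f) (α : Fin 2 → ℤ) {s t : ℝ}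
    (hs : s ∈ Ioo (0 : ℝ) 1) (ht : t ∈ Ioo (0 : ℝ) 1) :
    UnitAddTorus.mFourierCoeff (slice f s t) α =
      coeff f α * (s : ℂ) ^ α 0 * (t : ℂ) ^ (α 0 + α 1) := by
  have h2 : (2⁻¹ : ℝ) ∈ Ioo (0 : ℝ) 1 := by constructor <;> norm_num
  have hl : ((2⁻¹ : ℝ) : ℂ) ^ (-α 0) * UnitAddTorus.mFourierCoeff (slice f 2⁻¹ 2⁻¹) α =
      (s : ℂ) ^ (-α 0) * UnitAddTorus.mFourierCoeff (slice f s 2⁻¹) α := by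
    rcases le_total 2⁻¹ s with h | h
    · exact coeff_indep_left hf α h2 hs h h2
    · exact (coeff_indep_left hf α hs h2 h h2).symm
  have hr : ((2⁻¹ : ℝ) : ℂ) ^ (-(α 0 + α 1)) * UnitAddTorus.mFourierCoeff (slice f s 2⁻¹) α =
      (t : ℂ) ^ (-(α 0 + α 1)) * UnitAddTorus.mFourierCoeff (slice f s t) α := by
    rcases le_total 2⁻¹ t with h | h
    · exact coeff_indep_right hf α hs h2 ht h
    · exact (coeff_indep_right hf α hs ht h2 h).symm
  have hs0 : (s : ℂ) ≠ 0 := by simp [hs.1.ne']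
  have ht0 : (t : ℂ) ≠ 0 := by simp [ht.1.ne']
  have e : coeff f α = (s : ℂ) ^ (-α 0) * ((t : ℂ) ^ (-(α 0 + α 1)) *
      UnitAddTorus.mFourierCoeff (slice f s t) α) := by
    rw [← hr, mul_left_comm, ← hl, coeff]; ring
  rw [e, zpow_neg, zpow_neg]
  have a1 := zpow_ne_zero (α 0) hs0
  have a2 := zpow_ne_zero (α 0 + α 1) ht0
  field_simp

lemma parseval {F G : Torus → ℂ} (hF : Continuous F) (hG : Continuous G) :
    HasSum (fun α => conj (UnitAddTorus.mFourierCoeff F α) * UnitAddTorus.mFourierCoeff G α)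
      (∫ x, conj (F x) * G x ∂torusMeasure) := by
  have h := UnitAddTorus.hasSum_prod_mFourierCoeff
    (ContinuousMap.toLp 2 torusMeasure ℂ ⟨F, hF⟩) (ContinuousMap.toLp 2 torusMeasure ℂ ⟨G, hG⟩)
  have e1 : ∀ (H : C(Torus, ℂ)) (α : Fin 2 → ℤ), UnitAddTorus.mFourierCoeff
      (ContinuousMap.toLp 2 torusMeasure ℂ H) α = UnitAddTorus.mFourierCoeff H α :=
    fun H α => UnitAddTorus.mFourierCoeff_toLp H α
  simp only [e1] at h
  have e2 : ∫ x, conj (F x) * G x ∂torusMeasure =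
      ∫ x, conj (ContinuousMap.toLp 2 torusMeasure ℂ ⟨F, hF⟩ x) *
        ContinuousMap.toLp 2 torusMeasure ℂ ⟨G, hG⟩ x ∂torusMeasure := by
    refine integral_congr_ae ?_
    filter_upwards [ContinuousMap.coeFn_toLp (p := 2) (𝕜 := ℂ) torusMeasure ⟨F, hF⟩,
      ContinuousMap.coeFn_toLp (p := 2) (𝕜 := ℂ) torusMeasure ⟨G, hG⟩] with x h1 h2
    rw [h1, h2]; rfl
  rw [e2]
  exact h

/-- `(1 / 4π²) ∫∫ conj (f (s t e^{iθ}, t e^{iγ})) g (s t e^{iθ}, t e^{iγ}) s t² dθ dγ`. -/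
def innerMean (f g : triangle → ℂ) (s t : ℝ) : ℂ :=
  ∫ x, conj (slice f s t x) * slice g s t x * (s * t ^ 2) ∂torusMeasure

def weight (α : Fin 2 → ℤ) (s t : ℝ) : ℝ := s ^ (2 * α 0 + 1) * t ^ (2 * (α 0 + α 1 + 1))

lemma weight_eq (α : Fin 2 → ℤ) {s t : ℝ} (hs : s ∈ Ioo (0 : ℝ) 1) (ht : t ∈ Ioo (0 : ℝ) 1) :
    weight α s t = (s ^ α 0) ^ 2 * (t ^ (α 0 + α 1)) ^ 2 * (s * t ^ 2) := by
  have hs0 := hs.1.ne'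
  have ht0 := ht.1.ne'
  rw [weight, zpow_add₀ hs0, mul_add, zpow_add₀ ht0, mul_comm 2, mul_comm 2, zpow_mul, zpow_mul]
  norm_cast
  ring

lemma hasSum_innerMean {f g : triangle → ℂ} (hf : IsHolomorphic f) (hg : IsHolomorphic g) {s t : ℝ}
    (hs : s ∈ Ioo (0 : ℝ) 1) (ht : t ∈ Ioo (0 : ℝ) 1) :
    HasSum (fun α => conj (coeff f α) * coeff g α * (weight α s t : ℂ)) (innerMean f g s t) := by
  have h := (parseval (continuous_slice hf hs ht) (continuous_slice hg hs ht)).mul_right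
    ((s : ℂ) * t ^ 2)
  rw [← integral_mul_const (L := ℂ)] at h
  refine HasSum.congr_fun h fun α => ?_
  rw [mFourierCoeff_slice hf α hs ht, mFourierCoeff_slice hg α hs ht, weight_eq α hs ht]
  simp only [map_mul, map_zpow₀, Complex.conj_ofReal]
  push_cast
  ring

lemma innerMean_self (f : triangle → ℂ) (s t : ℝ) : innerMean f f s t = mean f s t := by
  rw [innerMean, mean, ← integral_complex_ofReal]
  congr 1; ext x
  rw [Complex.conj_mul']; push_cast; ring

lemma hasSum_mean {f : triangle → ℂ} (hf : IsHolomorphic f) {s t : ℝ}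
    (hs : s ∈ Ioo (0 : ℝ) 1) (ht : t ∈ Ioo (0 : ℝ) 1) :
    HasSum (fun α => ‖coeff f α‖ ^ 2 * weight α s t) (mean f s t) := by
  have h := hasSum_innerMean hf hf hs ht
  rw [innerMean_self] at h
  have := Complex.hasSum_re h
  simp only [Complex.ofReal_re] at this
  refine HasSum.congr_fun this fun α => ?_
  rw [Complex.conj_mul']; norm_cast

lemma weight_nonneg (α : Fin 2 → ℤ) {s t : ℝ} (hs : s ∈ Ioo (0 : ℝ) 1) (ht : t ∈ Ioo (0 : ℝ) 1) :
    0 ≤ weight α s t := by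
  have := hs.1; have := ht.1; rw [weight]; positivity

/-- The exponents that occur in functions of the Hardy space. -/
def indexSet : Set (Fin 2 → ℤ) := {α | 0 ≤ α 0 ∧ 0 ≤ α 0 + α 1 + 1}

lemma weight_le_one {α : Fin 2 → ℤ} (hα : α ∈ indexSet) {s t : ℝ} (hs : s ∈ Ioo (0 : ℝ) 1)
    (ht : t ∈ Ioo (0 : ℝ) 1) : weight α s t ≤ 1 := by
  have h1 : s ^ (2 * α 0 + 1) ≤ 1 := zpow_le_one₀ hs.1 hs.2.le (by have := hα.1; lia)
  have h2 : t ^ (2 * (α 0 + α 1 + 1)) ≤ 1 := zpow_le_one₀ ht.1 ht.2.le (by have := hα.2; lia)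
  have := ht.1
  exact mul_le_one₀ h1 (by positivity) h2

/-- The filter `(s, t) → (1, 1)` with `s < 1` and `t < 1`. -/
def toOne : Filter (ℝ × ℝ) := 𝓝[<] 1 ×ˢ 𝓝[<] 1

lemma eventually_toOne : ∀ᶠ p in toOne, p.1 ∈ Ioo (0 : ℝ) 1 ∧ p.2 ∈ Ioo (0 : ℝ) 1 := by
  have h : ∀ᶠ s in 𝓝[<] (1 : ℝ), s ∈ Ioo (0 : ℝ) 1 := Ioo_mem_nhdsLT one_pos
  exact h.prod_mk h

instance : toOne.NeBot := by unfold toOne; infer_instance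

lemma tendsto_weight (α : Fin 2 → ℤ) :
    Tendsto (fun p : ℝ × ℝ => weight α p.1 p.2) toOne (𝓝 1) := by
  have h : Tendsto (fun p : ℝ × ℝ => weight α p.1 p.2) (𝓝 ((1 : ℝ), (1 : ℝ))) (𝓝 (weight α 1 1)) := by
    unfold weight
    refine Tendsto.mul ?_ ?_
    · exact (continuousAt_zpow₀ (1 : ℝ) _ (Or.inl one_ne_zero)).tendsto.comp
        (continuous_fst.tendsto ((1 : ℝ), (1 : ℝ)))
    · exact (continuousAt_zpow₀ (1 : ℝ) _ (Or.inl one_ne_zero)).tendsto.comp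
        (continuous_snd.tendsto ((1 : ℝ), (1 : ℝ)))
  have e : weight α 1 1 = 1 := by simp [weight]
  rw [e] at h
  refine h.mono_left ?_
  rw [nhds_prod_eq]
  exact Filter.prod_mono nhdsWithin_le_nhds nhdsWithin_le_nhds

lemma coeff_eq_zero {f : triangle → ℂ} (hf : f ∈ hardySubspace) {α : Fin 2 → ℤ}
    (hα : α ∉ indexSet) : coeff f α = 0 := by
  obtain ⟨hf, C, hC⟩ := hf
  by_contra h0
  have h2 : (2⁻¹ : ℝ) ∈ Ioo (0 : ℝ) 1 := by constructor <;> norm_num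
  have hb : ∀ s ∈ Ioo (0 : ℝ) 1, ∀ t ∈ Ioo (0 : ℝ) 1, weight α s t ≤ C / ‖coeff f α‖ ^ 2 := by
    intro s hs t ht
    rw [le_div_iff₀ (by positivity), mul_comm]
    exact (le_hasSum (hasSum_mean hf hs ht) α fun β _ => mul_nonneg (by positivity)
      (weight_nonneg β hs ht)).trans (hC s hs t ht)
  have hT : ∀ n : ℤ, n < 0 → Tendsto (fun s : ℝ => s ^ n) (𝓝[>] 0) atTop := by
    intro n hn
    obtain ⟨k, rfl⟩ : ∃ k : ℕ, n = -(k + 1 : ℕ) := ⟨(-n - 1).toNat, by lia⟩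
    simp only [zpow_neg, zpow_natCast]
    refine ((tendsto_pow_atTop (Nat.succ_ne_zero k)).comp
      (tendsto_inv_nhdsGT_zero (𝕜 := ℝ))).congr fun x => ?_
    simp
  have hI : ∀ᶠ s in 𝓝[>] (0 : ℝ), s ∈ Ioo (0 : ℝ) 1 := Ioo_mem_nhdsGT one_pos
  rcases lt_or_ge (α 0) 0 with h | h
  · have := (hT (2 * α 0 + 1) (by lia)).atTop_mul_const
      (show (0 : ℝ) < 2⁻¹ ^ (2 * (α 0 + α 1 + 1)) by positivity)
    obtain ⟨s, h1, h3⟩ := ((this.eventually_gt_atTop (C / ‖coeff f α‖ ^ 2)).and hI).exists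
    exact absurd (hb s h3 _ h2) (not_le.2 h1)
  · have h' : α 0 + α 1 + 1 < 0 := by
      by_contra h''; exact hα ⟨h, by lia⟩
    have := (hT (2 * (α 0 + α 1 + 1)) (by lia)).const_mul_atTop
      (show (0 : ℝ) < 2⁻¹ ^ (2 * α 0 + 1) by positivity)
    obtain ⟨t, h1, h3⟩ := ((this.eventually_gt_atTop (C / ‖coeff f α‖ ^ 2)).and hI).exists
    exact absurd (hb _ h2 t h3) (not_le.2 h1)

lemma summable_coeff {f : triangle → ℂ} (hf : f ∈ hardySubspace) :
    Summable fun α => ‖coeff f α‖ ^ 2 := by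
  obtain ⟨hf, C, hC⟩ := hf
  refine summable_of_sum_le (c := C) (fun _ => by positivity) fun u => ?_
  have h1 : Tendsto (fun p : ℝ × ℝ => ∑ α ∈ u, ‖coeff f α‖ ^ 2 * weight α p.1 p.2) toOne
      (𝓝 (∑ α ∈ u, ‖coeff f α‖ ^ 2 * 1)) :=
    tendsto_finsetSum _ fun α _ => (tendsto_weight α).const_mul _
  simp only [mul_one] at h1
  refine le_of_tendsto h1 (eventually_toOne.mono fun p hp => ?_)
  exact (sum_le_hasSum u (fun β _ => mul_nonneg (by positivity) (weight_nonneg β hp.1 hp.2))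
    (hasSum_mean hf hp.1 hp.2)).trans (hC _ hp.1 _ hp.2)

lemma memlp_coeff {f : triangle → ℂ} (hf : f ∈ hardySubspace) : Memℓp (coeff f) 2 :=
  memℓp_gen (by simpa using summable_coeff hf)

lemma coeff_add {f g : triangle → ℂ} (hf : IsHolomorphic f) (hg : IsHolomorphic g) :
    coeff (f + g) = coeff f + coeff g := by
  ext α
  have h2 : (2⁻¹ : ℝ) ∈ Ioo (0 : ℝ) 1 := by constructor <;> norm_num
  simp only [coeff, fourierCoeff_eq, slice_add, Pi.add_apply, mul_add]
  rw [integral_add (integrable_of_continuous (continuous_coeff_integrand hf h2 h2 _ _))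
    (integrable_of_continuous (continuous_coeff_integrand hg h2 h2 _ _)), mul_add]

lemma coeff_smul (c : ℂ) (f : triangle → ℂ) : coeff (c • f) = c • coeff f := by
  ext α
  simp only [coeff, fourierCoeff_eq, slice_smul, Pi.smul_apply, smul_eq_mul, mul_left_comm _ c,
    integral_const_mul]

/-- The sequence of Laurent coefficients, as an element of `ℓ²`. -/
def coeffMap : HardySpace →ₗ[ℂ] lp (fun _ : Fin 2 → ℤ => ℂ) 2 where
  toFun f := ⟨coeff f, memlp_coeff f.2⟩
  map_add' f g := Subtype.ext (coeff_add f.2.1 g.2.1)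
  map_smul' c f := Subtype.ext (coeff_smul c f)

lemma coeffMap_apply (f : HardySpace) (α : Fin 2 → ℤ) : coeffMap f α = coeff f α := rfl

lemma coeffMap_injective : Function.Injective coeffMap := by
  rw [← LinearMap.ker_eq_bot, LinearMap.ker_eq_bot']
  intro f hf
  have hc : ∀ α, coeff f α = 0 := fun α => by rw [← coeffMap_apply, hf]; rfl
  have hm : ∀ s ∈ Ioo (0 : ℝ) 1, ∀ t ∈ Ioo (0 : ℝ) 1, ∀ x, slice f s t x = 0 := by
    intro s hs t ht
    have h := hasSum_mean f.coe_mem.1 hs ht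
    simp only [hc, norm_zero, zero_pow two_ne_zero, zero_mul] at h
    have h0 := h.unique hasSum_zero
    have cs := continuous_slice f.coe_mem.1 hs ht
    have hst : 0 < s * t ^ 2 := by have := hs.1; have := ht.1; positivity
    rw [mean, integral_eq_zero_iff_of_nonneg (fun x => by positivity)
      (integrable_of_continuous (by fun_prop)), Continuous.ae_eq_iff_eq _ (by fun_prop)
      continuous_zero] at h0
    intro x
    simpa [hst.ne'] using congrFun h0 x
  have hnz : ∀ z w : ℂ, z ≠ 0 → (z, w) ∈ triangle → extZero f (z, w) = 0 := by
    intro z w hz hp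
    have hw : 0 < ‖w‖ := (norm_nonneg z).trans_lt hp.1
    have hz' : 0 < ‖z‖ := norm_pos_iff.2 hz
    obtain ⟨a, ha⟩ := exists_toCircle hz
    obtain ⟨b, hb⟩ := exists_toCircle (norm_pos_iff.1 hw)
    have := hm (‖z‖ / ‖w‖) ⟨by positivity, (div_lt_one hw).2 hp.1⟩ ‖w‖ ⟨hw, hp.2⟩ ![a, b]
    simp only [slice, Matrix.cons_val_zero, Matrix.cons_val_one, ← hb] at this
    rwa [← Complex.ofReal_mul, div_mul_cancel₀ _ hw.ne', ← ha] at this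
  refine DFunLike.ext _ _ fun p => ?_
  obtain ⟨⟨z, w⟩, hp⟩ := p
  change (f : triangle → ℂ) ⟨(z, w), hp⟩ = 0
  rw [← extZero_of_mem f hp]
  by_cases hz : z = 0
  · subst hz
    have hcont : ContinuousAt (fun z : ℂ => extZero f (z, w)) 0 :=
      (f.coe_mem.1.continuousOn.continuousAt (isOpen_triangle.mem_nhds hp)).comp
        (f := fun z : ℂ => (z, w)) (by fun_prop)
    have hev : ∀ᶠ z in 𝓝[≠] (0 : ℂ), extZero f (z, w) = 0 := by
      have h1 : ∀ᶠ z in 𝓝 (0 : ℂ), (z, w) ∈ triangle :=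
        (show Continuous fun z : ℂ => (z, w) by fun_prop).continuousAt.eventually
          (isOpen_triangle.mem_nhds hp)
      filter_upwards [h1.filter_mono nhdsWithin_le_nhds, self_mem_nhdsWithin] with z h2 h3
      exact hnz z w h3 h2
    refine tendsto_nhds_unique (hcont.tendsto.mono_left nhdsWithin_le_nhds) ?_ (l := 𝓝[≠] (0 : ℂ))
    exact tendsto_const_nhds.congr' (hev.mono fun _ h => h.symm)
  · exact hnz z w hz hp

lemma tendsto_innerMean (f g : HardySpace) :
    Tendsto (fun p : ℝ × ℝ => innerMean f g p.1 p.2) toOne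
      (𝓝 (inner ℂ (coeffMap f) (coeffMap g))) := by
  rw [lp.inner_eq_tsum]
  have hb : Summable fun α => ‖coeff f α‖ * ‖coeff g α‖ := by
    refine Summable.of_nonneg_of_le (fun _ => by positivity) (fun α => ?_)
      ((summable_coeff f.2).add (summable_coeff g.2))
    show _ ≤ ‖coeff f α‖ ^ 2 + ‖coeff g α‖ ^ 2
    nlinarith [sq_nonneg (‖coeff f α‖ - ‖coeff g α‖), norm_nonneg (coeff f α),
      norm_nonneg (coeff g α)]
  have h := tendsto_tsum_of_dominated_convergence (𝓕 := toOne)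
    (f := fun (p : ℝ × ℝ) α => conj (coeff f α) * coeff g α * (weight α p.1 p.2 : ℂ))
    (g := fun α => inner ℂ (coeffMap f α) (coeffMap g α)) hb
    (fun α => by
      have := ((Complex.continuous_ofReal.tendsto 1).comp (tendsto_weight α)).const_mul
        (conj (coeff f α) * coeff g α)
      simp only [Complex.ofReal_one, mul_one] at this
      rw [RCLike.inner_apply']
      exact this)
    (eventually_toOne.mono fun p hp α => by
      by_cases hα : α ∈ indexSet
      · have h1 := weight_le_one hα hp.1 hp.2
        have h2 := weight_nonneg α hp.1 hp.2
        simp only [norm_mul, RCLike.norm_conj, Complex.norm_real, Real.norm_eq_abs, abs_of_nonneg h2]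
        exact mul_le_of_le_one_right (by positivity) h1
      · simp [coeff_eq_zero f.coe_mem hα])
  refine h.congr' (eventually_toOne.mono fun p hp => ?_)
  exact (hasSum_innerMean f.2.1 g.2.1 hp.1 hp.2).tsum_eq

/-! ### The Hilbert space structure -/

/-- The inner product of the Hardy space, conjugate-linear in the first variable: the limit of the
weighted integrals as `s, t → 1`. -/
def innerProd (f g : HardySpace) : ℂ := limUnder toOne fun p : ℝ × ℝ => innerMean f g p.1 p.2

lemma innerProd_eq (f g : HardySpace) : innerProd f g = inner ℂ (coeffMap f) (coeffMap g) :=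
  (tendsto_innerMean f g).limUnder_eq

@[reducible]
def innerCore : InnerProductSpace.Core ℂ HardySpace where
  inner := innerProd
  conj_inner_symm f g := by simp only [innerProd_eq]; exact inner_conj_symm _ _
  re_inner_nonneg f := by simp only [innerProd_eq]; exact inner_self_nonneg
  add_left f g h := by simp only [innerProd_eq, map_add, inner_add_left]
  smul_left f g c := by simp only [innerProd_eq, map_smul, inner_smul_left]
  definite f hf := by
    simp only [innerProd_eq, inner_self_eq_zero] at hf
    exact coeffMap_injective (hf.trans (map_zero _).symm)

instance : NormedAddCommGroup HardySpace := innerCore.toNormedAddCommGroup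

instance : InnerProductSpace ℂ HardySpace := InnerProductSpace.ofCore innerCore.toCore

lemma inner_eq (f g : HardySpace) : inner ℂ f g = inner ℂ (coeffMap f) (coeffMap g) :=
  innerProd_eq f g

lemma norm_coeffMap (f : HardySpace) : ‖coeffMap f‖ = ‖f‖ := by
  rw [@norm_eq_sqrt_re_inner ℂ, @norm_eq_sqrt_re_inner ℂ _ _ _ _ f, inner_eq]

/-- The exponents of the monomial `w⁻¹ * (z / w) ^ m * w ^ n`. -/
def idx (p : ℕ × ℕ) : Fin 2 → ℤ := ![p.1, p.2 - 1 - p.1]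

lemma idx_injective : Function.Injective idx := by
  rintro ⟨m, n⟩ ⟨m', n'⟩ h
  have h0 := congrFun h 0
  have h1 := congrFun h 1
  simp [idx] at h0 h1
  ext <;> simp <;> lia

lemma mem_range_idx {α : Fin 2 → ℤ} (hα : α ∈ indexSet) : α ∈ range idx := by
  refine ⟨((α 0).toNat, (α 0 + α 1 + 1).toNat), ?_⟩
  have h1 := hα.1
  have h2 := hα.2
  ext i
  fin_cases i
  · simp [idx, h1]
  · simp [idx, h1, h2]

lemma differentiableOn_powerSeries {b : ℕ × ℕ → ℂ} {B : ℝ} (hb : ∀ p, ‖b p‖ ≤ B) :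
    DifferentiableOn ℂ (fun u : ℂ × ℂ => ∑' p, b p * (u.1 ^ p.1 * u.2 ^ p.2)) (Metric.ball 0 1) := by
  intro u hu
  obtain ⟨r, hr1, hr2⟩ := exists_between (show ‖u‖ < 1 by simpa using hu)
  have hr0 : 0 ≤ r := (norm_nonneg u).trans hr1.le
  have hB : 0 ≤ B := (norm_nonneg _).trans (hb 0)
  have g0 : Summable fun n : ℕ => r ^ n := summable_geometric_of_lt_one hr0 hr2
  have g1 : Summable fun n : ℕ => (n : ℝ) * r ^ (n - 1) := by
    rw [← summable_nat_add_iff 1]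
    have h1 := summable_pow_mul_geometric_of_norm_lt_one (R := ℝ) 1 (r := r)
      (by rwa [Real.norm_of_nonneg hr0])
    refine (h1.add g0).congr fun n => ?_
    simp; ring
  have hsum : Summable fun p : ℕ × ℕ =>
      B * (r ^ p.1 * ((p.2 : ℝ) * r ^ (p.2 - 1)) + r ^ p.2 * ((p.1 : ℝ) * r ^ (p.1 - 1))) := by
    refine Summable.mul_left B (Summable.add ?_ ?_)
    · exact g0.mul_of_nonneg g1 (fun _ => by positivity) (fun _ => by positivity)
    · exact (g1.mul_of_nonneg g0 (fun _ => by positivity) (fun _ => by positivity)).congr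
        fun p => mul_comm _ _
  refine (hasFDerivAt_tsum_of_isPreconnected (f := fun (p : ℕ × ℕ) (u : ℂ × ℂ) =>
      b p * (u.1 ^ p.1 * u.2 ^ p.2))
    (f' := fun p x => b p • (x.1 ^ p.1 • (((p.2 : ℂ) * x.2 ^ (p.2 - 1)) •
      ContinuousLinearMap.snd ℂ ℂ ℂ) + x.2 ^ p.2 • (((p.1 : ℂ) * x.1 ^ (p.1 - 1)) •
      ContinuousLinearMap.fst ℂ ℂ ℂ))) (s := Metric.ball 0 r) hsum Metric.isOpen_ball
    (convex_ball _ _).isPreconnected (fun p x _ => ?_) (fun p x hx => ?_)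
    (Metric.mem_ball_self (by linarith [norm_nonneg u])) ?_
    (show u ∈ Metric.ball 0 r by simpa using hr1)).differentiableAt.differentiableWithinAt
  · exact (((hasDerivAt_pow p.1 x.1).comp_hasFDerivAt x hasFDerivAt_fst).mul
      ((hasDerivAt_pow p.2 x.2).comp_hasFDerivAt x hasFDerivAt_snd)).const_mul (b p)
  · have hx' : ‖x‖ < r := by simpa using hx
    have h1 : ‖x.1‖ ≤ r := (norm_fst_le x).trans hx'.le
    have h2 : ‖x.2‖ ≤ r := (norm_snd_le x).trans hx'.le
    have k1 := ContinuousLinearMap.norm_fst_le ℂ ℂ ℂ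
    have k2 := ContinuousLinearMap.norm_snd_le ℂ ℂ ℂ
    rw [norm_smul]
    refine mul_le_mul (hb p) ((norm_add_le _ _).trans (add_le_add ?_ ?_)) (norm_nonneg _) hB
    · rw [norm_smul, norm_smul, norm_mul, norm_pow, norm_pow, Complex.norm_natCast]
      have : ‖x.1‖ ^ p.1 * (p.2 * ‖x.2‖ ^ (p.2 - 1) * ‖ContinuousLinearMap.snd ℂ ℂ ℂ‖) ≤
        r ^ p.1 * (p.2 * r ^ (p.2 - 1) * 1) := by gcongr
      simpa using this
    · rw [norm_smul, norm_smul, norm_mul, norm_pow, norm_pow, Complex.norm_natCast]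
      have : ‖x.2‖ ^ p.2 * (p.1 * ‖x.1‖ ^ (p.1 - 1) * ‖ContinuousLinearMap.fst ℂ ℂ ℂ‖) ≤
        r ^ p.2 * (p.1 * r ^ (p.1 - 1) * 1) := by gcongr
      simpa using this
  · refine summable_of_ne_finset_zero (s := {0}) fun p hp => ?_
    have : p.1 ≠ 0 ∨ p.2 ≠ 0 := by
      by_contra! h; exact hp (by simp [Prod.ext_iff, h.1, h.2])
    rcases this with h | h <;> simp [h]

lemma summable_powerSeries {b : ℕ × ℕ → ℂ} {B : ℝ} (hb : ∀ p, ‖b p‖ ≤ B) {u v : ℂ} (hu : ‖u‖ < 1)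
    (hv : ‖v‖ < 1) : Summable fun p : ℕ × ℕ => b p * (u ^ p.1 * v ^ p.2) := by
  have h := (summable_geometric_of_lt_one (norm_nonneg u) hu).mul_of_nonneg
    (summable_geometric_of_lt_one (norm_nonneg v) hv) (fun _ => by positivity)
    (fun _ => by positivity)
  refine Summable.of_norm_bounded (h.mul_left B) fun p => ?_
  rw [norm_mul, norm_mul, norm_pow, norm_pow]
  exact mul_le_mul_of_nonneg_right (hb p) (by positivity)

lemma mFourierCoeff_of_hasSum {c : (Fin 2 → ℤ) → ℂ} (hc : Summable c) {F : Torus → ℂ}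
    (hF : ∀ x, HasSum (fun α => c α * UnitAddTorus.mFourier α x) (F x)) (β : Fin 2 → ℤ) :
    UnitAddTorus.mFourierCoeff F β = c β := by
  have hs : Summable fun α => c α • UnitAddTorus.mFourier α := by
    refine Summable.of_norm ?_
    simpa [norm_smul, UnitAddTorus.mFourier_norm] using hc.norm
  obtain ⟨K, hK⟩ := hs
  have hKF : F = K := by
    ext x
    refine (hF x).unique ?_
    exact (ContinuousMap.evalCLM ℂ x).hasSum hK
  have h1 := (ContinuousMap.toLp (E := ℂ) 2 torusMeasure ℂ).hasSum hK
  have h2 := (innerSL ℂ (UnitAddTorus.mFourierBasis (d := Fin 2) β)).hasSum h1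
  have h3 : (innerSL ℂ (UnitAddTorus.mFourierBasis (d := Fin 2) β))
      ((ContinuousMap.toLp (E := ℂ) 2 torusMeasure ℂ) K) = UnitAddTorus.mFourierCoeff F β := by
    rw [innerSL_apply_apply, ← HilbertBasis.repr_apply_apply, UnitAddTorus.mFourierBasis_repr, hKF]
    exact UnitAddTorus.mFourierCoeff_toLp K β
  rw [h3] at h2
  refine h2.unique ?_
  refine HasSum.congr_fun (hasSum_ite_eq β (c β)) fun α => ?_
  have := orthonormal_iff_ite.1 (UnitAddTorus.mFourierBasis (d := Fin 2)).orthonormal β α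
  rw [UnitAddTorus.coe_mFourierBasis] at this
  rw [UnitAddTorus.coe_mFourierBasis, map_smul, map_smul, innerSL_apply_apply]
  refine (congrArg (c α • ·) this).trans ?_
  by_cases h : α = β
  · simp [h]
  · simp [h, Ne.symm h]

/-- The function with prescribed coefficients. -/
def ofCoeff (a : (Fin 2 → ℤ) → ℂ) (p : triangle) : ℂ :=
  p.1.2⁻¹ * ∑' n : ℕ × ℕ, a (idx n) * ((p.1.1 / p.1.2) ^ n.1 * p.1.2 ^ n.2)

lemma isHolomorphic_ofCoeff {a : (Fin 2 → ℤ) → ℂ} {B : ℝ} (ha : ∀ α, ‖a α‖ ≤ B) :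
    IsHolomorphic (ofCoeff a) := by
  have hG := differentiableOn_powerSeries fun p => ha (idx p)
  have hne : ∀ p ∈ triangle, p.2 ≠ 0 := fun p hp h => by
    have := hp.1
    rw [h, norm_zero] at this
    exact absurd this (not_lt.2 (norm_nonneg _))
  have h2 : DifferentiableOn ℂ (fun p : ℂ × ℂ => (p.1 / p.2, p.2)) triangle := fun p hp => by
    have := hne p hp
    simp only [div_eq_mul_inv]
    fun_prop (disch := assumption)
  have h3 : DifferentiableOn ℂ (fun p : ℂ × ℂ => p.2⁻¹) triangle := fun p hp => by
    have := hne p hp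
    fun_prop (disch := assumption)
  refine (h3.mul (hG.comp h2 fun p hp => ?_)).congr fun p hp => extZero_of_mem _ hp
  have hw : 0 < ‖p.2‖ := (norm_nonneg _).trans_lt hp.1
  simp only [Metric.mem_ball, dist_zero_right, Prod.norm_def, norm_div, sup_lt_iff]
  exact ⟨(div_lt_one hw).2 hp.1, hp.2⟩

lemma coeff_ofCoeff {a : (Fin 2 → ℤ) → ℂ} {B : ℝ} (ha : ∀ α, ‖a α‖ ≤ B)
    (h0 : ∀ α ∉ indexSet, a α = 0) (β : Fin 2 → ℤ) : coeff (ofCoeff a) β = a β := by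
  have h2 : (2⁻¹ : ℝ) ∈ Ioo (0 : ℝ) 1 := by constructor <;> norm_num
  have hn : ((2⁻¹ : ℝ) : ℂ) ≠ 0 := by norm_num
  have hn1 : ‖((2⁻¹ : ℝ) : ℂ)‖ < 1 := by norm_num
  set r : ℂ := ((2⁻¹ : ℝ) : ℂ) with hr
  set c : (Fin 2 → ℤ) → ℂ := fun α => a α * (r ^ α 0 * r ^ (α 0 + α 1)) with hcdef
  have hc0 : ∀ α ∉ range idx, c α = 0 := fun α hα => by
    simp [hcdef, h0 α fun h => hα (mem_range_idx h)]
  have hcidx : ∀ p : ℕ × ℕ, c (idx p) = r⁻¹ * (a (idx p) * (r ^ p.1 * r ^ p.2)) := by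
    intro p
    have : idx p 0 + idx p 1 = p.2 - 1 := by simp [idx]
    simp only [hcdef, this]
    rw [zpow_sub₀ hn]
    simp [idx]
    ring
  have hcs : Summable c := by
    rw [← idx_injective.summable_iff hc0]
    exact ((summable_powerSeries (fun p => ha (idx p)) hn1 hn1).mul_left r⁻¹).congr
      fun p => (hcidx p).symm
  have key := mFourierCoeff_of_hasSum hcs (F := slice (ofCoeff a) 2⁻¹ 2⁻¹) (fun x => ?_) β
  · rw [coeff, key, ← hr]
    simp only [hcdef, zpow_neg]
    have a1 := zpow_ne_zero (β 0) hn
    have a2 := zpow_ne_zero (β 0 + β 1) hn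
    field_simp
  · rw [slice_apply _ h2 h2, ← idx_injective.hasSum_iff (fun α hα => by rw [hc0 α hα, zero_mul])]
    have e0 : ((x 0).toCircle : ℂ) ≠ 0 := Circle.coe_ne_zero _
    have e1 : ((x 1).toCircle : ℂ) ≠ 0 := Circle.coe_ne_zero _
    have hu : ‖r * r * ((x 0).toCircle : ℂ) / (r * ((x 1).toCircle : ℂ))‖ < 1 := by
      simp only [norm_mul, norm_div, Circle.norm_coe, mul_one]
      rw [mul_div_cancel_right₀ _ (by simpa using hn)]
      exact hn1
    have hv : ‖r * ((x 1).toCircle : ℂ)‖ < 1 := by rwa [norm_mul, Circle.norm_coe, mul_one]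
    refine HasSum.congr_fun ((summable_powerSeries (fun p => ha (idx p)) hu hv).hasSum.mul_left
      (r * ((x 1).toCircle : ℂ))⁻¹) fun p => ?_
    simp only [Function.comp_apply, hcidx]
    have e2 : UnitAddTorus.mFourier (idx p) x =
        ((x 0).toCircle : ℂ) ^ p.1 * (((x 1).toCircle : ℂ) ^ p.2 *
          ((x 1).toCircle : ℂ)⁻¹ * (((x 1).toCircle : ℂ) ^ p.1)⁻¹) := by
      simp only [UnitAddTorus.mFourier, ContinuousMap.coe_mk, Fin.prod_univ_two, fourier_apply,
        AddCircle.toCircle_zsmul, idx, Matrix.cons_val_zero, Matrix.cons_val_one, Circle.coe_zpow]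
      rw [zpow_sub₀ e1, zpow_sub₀ e1]
      simp [div_eq_mul_inv]
    rw [e2, mul_assoc r r, mul_div_mul_left _ _ hn, div_pow, mul_pow, mul_pow]
    field_simp

lemma ofCoeff_mem {a : lp (fun _ : Fin 2 → ℤ => ℂ) 2} (h0 : ∀ α ∉ indexSet, a α = 0) :
    ofCoeff a ∈ hardySubspace := by
  have ha : ∀ α, ‖a α‖ ≤ ‖a‖ := lp.norm_apply_le_norm (by norm_num) a
  have hol := isHolomorphic_ofCoeff ha
  have hs : Summable fun α => ‖a α‖ ^ 2 := by
    simpa using (lp.memℓp a).summable (by norm_num)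
  refine ⟨hol, ∑' α, ‖a α‖ ^ 2, fun s hs' t ht => ?_⟩
  refine hasSum_le (fun α => ?_) (hasSum_mean hol hs' ht) hs.hasSum
  rw [coeff_ofCoeff ha h0]
  by_cases hα : α ∈ indexSet
  · exact mul_le_of_le_one_right (by positivity) (weight_le_one hα hs' ht)
  · simp [h0 α hα]

lemma range_coeffMap : range coeffMap = {a | ∀ α ∉ indexSet, a α = 0} := by
  ext a
  constructor
  · rintro ⟨f, rfl⟩ α hα
    exact coeff_eq_zero f.coe_mem hα
  · intro h0
    refine ⟨⟨ofCoeff a, ofCoeff_mem h0⟩, ?_⟩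
    ext α
    exact coeff_ofCoeff (lp.norm_apply_le_norm (by norm_num) a) h0 α

instance : CompleteSpace HardySpace := by
  have hiso : Isometry coeffMap := AddMonoidHomClass.isometry_of_norm _ norm_coeffMap
  refine hiso.isUniformInducing.completeSpace ?_
  rw [range_coeffMap]
  refine IsClosed.isComplete ?_
  simp only [ofPred_forall]
  refine isClosed_iInter fun α => isClosed_iInter fun _ => isClosed_eq ?_ continuous_const
  exact (lp.evalCLM ℂ (fun _ : Fin 2 → ℤ => ℂ) 2 α).continuous

/-- The squared norm is the supremum of the integral means. -/
theorem isLUB_norm_sq (f : HardySpace) :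
    IsLUB {m | ∃ s ∈ Ioo (0 : ℝ) 1, ∃ t ∈ Ioo (0 : ℝ) 1, m = mean f s t} (‖f‖ ^ 2) := by
  have hT : Tendsto (fun p : ℝ × ℝ => mean f p.1 p.2) toOne (𝓝 (‖f‖ ^ 2)) := by
    have h := (Complex.continuous_re.tendsto _).comp (tendsto_innerMean f f)
    rw [← inner_eq, inner_self_eq_norm_sq_to_K] at h
    simp only [Function.comp_def, innerMean_self, Complex.ofReal_re] at h
    convert h using 2
    norm_cast
  have hn : ‖f‖ ^ 2 = ∑' α, ‖coeff f α‖ ^ 2 := by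
    rw [← norm_coeffMap]
    simpa [coeffMap_apply] using lp.norm_rpow_eq_tsum (p := 2) (by norm_num) (coeffMap f)
  refine ⟨?_, fun b hb => le_of_tendsto hT (eventually_toOne.mono fun p hp =>
    hb ⟨_, hp.1, _, hp.2, rfl⟩)⟩
  rintro _ ⟨s, hs, t, ht, rfl⟩
  rw [hn]
  refine hasSum_le (fun α => ?_) (hasSum_mean f.coe_mem.1 hs ht) (summable_coeff f.coe_mem).hasSum
  by_cases hα : α ∈ indexSet
  · exact mul_le_of_le_one_right (by positivity) (weight_le_one hα hs ht)
  · simp [coeff_eq_zero f.coe_mem hα]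

/-! ### Multiplication operators and submodules -/

lemma extZero_mul (f g : triangle → ℂ) : extZero (f * g) = extZero f * extZero g := by
  ext p
  by_cases hp : p ∈ triangle
  · simp [extZero_of_mem _ hp]
  · have : ¬ ∃ a : triangle, a.1 = p := by rintro ⟨a, rfl⟩; exact hp a.2
    simp [extZero, Function.extend_apply' _ _ _ this]

lemma mean_mul_le {h f : triangle → ℂ} (hh : IsHolomorphic h) (hb : ∀ p, ‖h p‖ ≤ 1)
    (hf : IsHolomorphic f) {s t : ℝ} (hs : s ∈ Ioo (0 : ℝ) 1) (ht : t ∈ Ioo (0 : ℝ) 1) :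
    mean (h * f) s t ≤ mean f s t := by
  have hhf : IsHolomorphic (h * f) := by rw [IsHolomorphic, extZero_mul]; exact hh.mul hf
  have c1 := continuous_slice hhf hs ht
  have c2 := continuous_slice hf hs ht
  refine integral_mono (integrable_of_continuous (by fun_prop))
    (integrable_of_continuous (by fun_prop)) fun x => ?_
  have h0 : 0 ≤ s * t ^ 2 := by have := hs.1; positivity
  have h1 : ‖slice (h * f) s t x‖ ≤ ‖slice f s t x‖ := by
    rw [slice_apply _ hs ht, slice_apply _ hs ht, Pi.mul_apply, norm_mul]
    exact mul_le_of_le_one_left (norm_nonneg _) (hb _)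
  gcongr

/-- Multiplication by a holomorphic function bounded by one. -/
def mulOp (h : triangle → ℂ) (hh : IsHolomorphic h) (hb : ∀ p, ‖h p‖ ≤ 1) :
    HardySpace →L[ℂ] HardySpace :=
  LinearMap.mkContinuous
    { toFun := fun f => ⟨h * f, by
        rw [IsHolomorphic, extZero_mul]; exact hh.mul f.coe_mem.1,
          f.coe_mem.2.imp fun _ hC s hs t ht => (mean_mul_le hh hb f.coe_mem.1 hs ht).trans (hC s hs t ht)⟩
      map_add' := fun f g => Subtype.ext (mul_add h f.1 g.1)
      map_smul' := fun c f => Subtype.ext (mul_smul_comm c h f.1) } 1 (by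
    intro f
    rw [one_mul, ← sq_le_sq₀ (norm_nonneg _) (norm_nonneg _)]
    refine (isLUB_norm_sq _).2 ?_
    rintro _ ⟨s, hs, t, ht, rfl⟩
    exact (mean_mul_le hh hb f.coe_mem.1 hs ht).trans ((isLUB_norm_sq f).1 ⟨s, hs, t, ht, rfl⟩))

lemma isHolomorphic_of_differentiable {F : ℂ × ℂ → ℂ} (hF : Differentiable ℂ F) :
    IsHolomorphic fun p => F p :=
  hF.differentiableOn.congr fun _ hp => extZero_of_mem _ hp

/-- Multiplication by the first coordinate. -/
def Mz : HardySpace →L[ℂ] HardySpace :=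
  mulOp (fun p => p.1.1) (isHolomorphic_of_differentiable differentiable_fst)
    fun p => (p.2.1.trans p.2.2).le

/-- Multiplication by the second coordinate. -/
def Mw : HardySpace →L[ℂ] HardySpace :=
  mulOp (fun p => p.1.2) (isHolomorphic_of_differentiable differentiable_snd) fun p => p.2.2.le

theorem Mz_apply (f : HardySpace) (p : triangle) : Mz f p = p.1.1 * f p := rfl

theorem Mw_apply (f : HardySpace) (p : triangle) : Mw f p = p.1.2 * f p := rfl

/-- A submodule of the Hardy space: a closed subspace invariant under `Mz` and `Mw`. -/
structure HardySubmodule extends Submodule ℂ HardySpace where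
  isClosed' : IsClosed (toSubmodule : Set HardySpace)
  Mz_mem' : ∀ f ∈ toSubmodule, Mz f ∈ toSubmodule
  Mw_mem' : ∀ f ∈ toSubmodule, Mw f ∈ toSubmodule

namespace HardySubmodule

instance (S : HardySubmodule) : CompleteSpace S.toSubmodule :=
  S.isClosed'.completeSpace_coe

/-- The restriction of `Mz` to the submodule. -/
def Sz (S : HardySubmodule) : S.toSubmodule →L[ℂ] S.toSubmodule := Mz.restrict S.Mz_mem'

/-- The restriction of `Mw` to the submodule. -/
def Sw (S : HardySubmodule) : S.toSubmodule →L[ℂ] S.toSubmodule := Mw.restrict S.Mw_mem'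

/-- `[S_z*, S_w] = 0`. -/
def IsDoublyCommuting (S : HardySubmodule) : Prop :=
  ⁅ContinuousLinearMap.adjoint S.Sz, S.Sw⁆ = 0

end HardySubmodule

/-- The functions in the Hardy space that are sums of a power series `∑ a_{ij} z ^ i w ^ j` with
`i, j ≥ 0`. -/
def hardyPlus : Set HardySpace :=
  {f | ∃ a : ℕ → ℕ → ℂ, ∀ p : triangle,
    HasSum (fun n : ℕ × ℕ => a n.1 n.2 * p.1.1 ^ n.1 * p.1.2 ^ n.2) (f p)}

/-- `F` is the boundary function of `f` on `𝕋²`: the dilates of `f` converge to `F` in `L²(𝕋²)`. -/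
def IsBoundaryFunction (f : triangle → ℂ) (F : Torus → ℂ) : Prop :=
  MemLp F 2 torusMeasure ∧
    Tendsto (fun p : ℝ × ℝ => eLpNorm (fun x => slice f p.1 p.2 x - F x) 2 torusMeasure) toOne (𝓝 0)

/-- `f` is unimodular: its boundary function has modulus one almost everywhere on `𝕋²`. -/
def IsUnimodular (f : triangle → ℂ) : Prop :=
  ∃ F : Torus → ℂ, IsBoundaryFunction f F ∧ ∀ᵐ x ∂torusMeasure, ‖F x‖ = 1

end Hartogs

end

/-!
The operators `S_z` and `S_w` are pure isometries. If they doubly commute, Słociński's Wold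
decomposition writes `S` as the orthogonal sum of the translates `z ^ i * w ^ j * W` of the joint
wandering subspace `W = ker S_z* ∩ ker S_w*`. For `u, v ∈ W` the orthogonality of different
translates computes the Fourier coefficients of `conj u * v` on the torus: all of them vanish except
the one of index zero, which is the inner product of `u` and `v`. For a unit vector `u = v = q` this
says that `|q| = 1` almost everywhere, and for `u = q` and `v` orthogonal to `q` it gives `v = 0`.
Hence `W` is spanned by the unimodular function `q`, and `S` is the closed span of the orthonormal
family `z ^ i * w ^ j * q`, which is `q * H²₊`.

Conversely, if `q` is unimodular, then `z ^ i * w ^ j * q` is an orthonormal basis of `q * H²₊`, on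
which `S_z` and `S_w` act as the two coordinate shifts of `ℕ × ℕ`, and these doubly commute.
-/

noncomputable section

open MeasureTheory Filter Topology Set
open scoped ComplexConjugate ENNReal

namespace Hartogs

/-! ### Doubly commuting isometries -/

section Isometry

open ContinuousLinearMap (adjoint adjoint_inner_left adjoint_inner_right)

variable {𝕜 K : Type*} [RCLike 𝕜] [NormedAddCommGroup K] [InnerProductSpace 𝕜 K]

/-- An operator is pure if no nonzero vector lies in the range of all of its powers. For an isometry
this means that its Wold decomposition has no unitary part. -/
def IsPure (V : K →L[𝕜] K) : Prop := ⨅ n : ℕ, (V ^ n).range = ⊥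

lemma coe_restrict_pow_apply (A : K →L[𝕜] K) {S : Submodule 𝕜 K} (hA : ∀ x ∈ S, A x ∈ S) (n : ℕ)
    (x : S) : ((A.restrict hA ^ n) x : K) = (A ^ n) x := by
  induction n generalizing x with
  | zero => rfl
  | succ n ih =>
    simp only [pow_succ, mul_apply_eq_comp, ih, ContinuousLinearMap.coe_restrict_apply]

lemma IsPure.restrict {A : K →L[𝕜] K} (h : IsPure A) {S : Submodule 𝕜 K}
    (hA : ∀ x ∈ S, A x ∈ S) : IsPure (A.restrict hA) := by
  refine (Submodule.eq_bot_iff _).2 fun x hx => Subtype.ext ?_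
  refine (Submodule.eq_bot_iff _).1 h _ (Submodule.mem_iInf _ |>.2 fun n => ?_)
  obtain ⟨y, rfl⟩ := (Submodule.mem_iInf _).1 hx n
  exact ⟨y, (coe_restrict_pow_apply A hA n y).symm⟩

lemma pow_apply_mem_ker {A B : K →L[𝕜] K} (h : Commute A B) {x : K} (hx : A x = 0) (n : ℕ) :
    A ((B ^ n) x) = 0 := by
  rw [← mul_apply_eq_comp, (h.pow_right n).eq, mul_apply_eq_comp, hx, map_zero]

variable [CompleteSpace K] {V U : K →L[𝕜] K}

lemma adjoint_pow_mul_pow (hV : adjoint V * V = 1) (n : ℕ) : adjoint (V ^ n) * V ^ n = 1 := by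
  rw [← ContinuousLinearMap.star_eq_adjoint, star_pow]
  exact pow_mul_pow_eq_one n hV

lemma inner_pow_apply_of_lt (hV : adjoint V * V = 1) {x : K} (hx : adjoint V x = 0) (y : K)
    {i k : ℕ} (h : i < k) : inner 𝕜 ((V ^ i) x) ((V ^ k) y) = 0 := by
  obtain ⟨m, rfl⟩ := Nat.exists_eq_add_of_lt h
  rw [add_assoc, pow_add, mul_apply_eq_comp, ← adjoint_inner_right, ← mul_apply_eq_comp,
    adjoint_pow_mul_pow hV, one_apply_eq_self, pow_succ', mul_apply_eq_comp, ← adjoint_inner_left,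
    hx, inner_zero_left]

lemma inner_pow_apply_pow_apply (hV : adjoint V * V = 1) {x y : K} (hx : adjoint V x = 0)
    (hy : adjoint V y = 0) (i k : ℕ) :
    inner 𝕜 ((V ^ i) x) ((V ^ k) y) = if i = k then inner 𝕜 x y else 0 := by
  rcases lt_trichotomy i k with h | rfl | h
  · rw [if_neg h.ne, inner_pow_apply_of_lt hV hx y h]
  · rw [if_pos rfl, ← adjoint_inner_right, ← mul_apply_eq_comp, adjoint_pow_mul_pow hV,
      one_apply_eq_self]
  · rw [if_neg h.ne', inner_eq_zero_symm, inner_pow_apply_of_lt hV hy x h]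

/-- The defect operator `1 - V V*`. If `V` is an isometry, it is the orthogonal projection onto the
wandering subspace `ker V*`. -/
def wanderingProj (V : K →L[𝕜] K) : K →L[𝕜] K := 1 - V * adjoint V

lemma adjoint_wanderingProj (hV : adjoint V * V = 1) (x : K) :
    adjoint V (wanderingProj V x) = 0 := by
  rw [wanderingProj, ← mul_apply_eq_comp, mul_sub, ← mul_assoc, hV, mul_one, one_mul, sub_self,
    zero_apply]

lemma inner_wanderingProj {u : K} (hu : adjoint V u = 0) (x : K) :
    inner 𝕜 u (wanderingProj V x) = inner 𝕜 u x := by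
  rw [wanderingProj, sub_apply, one_apply_eq_self, inner_sub_right,
    mul_apply_eq_comp, ← adjoint_inner_left, hu, inner_zero_left, sub_zero]

lemma IsPure.eq_zero_of_wanderingProj (hV : IsPure V) {x : K}
    (hx : ∀ n : ℕ, wanderingProj V ((adjoint V ^ n) x) = 0) : x = 0 := by
  refine (Submodule.eq_bot_iff _).1 hV x ((Submodule.mem_iInf _).2 fun n => ?_)
  refine ⟨(adjoint V ^ n) x, ?_⟩
  induction n with
  | zero => rfl
  | succ n ih =>
    have h : (adjoint V ^ n) x = V (adjoint V ((adjoint V ^ n) x)) := sub_eq_zero.1 (hx n)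
    rw [pow_succ' (adjoint V), pow_succ V, mul_apply_eq_comp]
    exact (congrArg (V ^ n) h).symm.trans ih

/-- A pair of commuting isometries each of which commutes with the adjoint of the other. -/
structure IsDoublyCommutingPair (V U : K →L[𝕜] K) : Prop where
  adjoint_mul_left : adjoint V * V = 1
  adjoint_mul_right : adjoint U * U = 1
  commute : Commute V U
  adjoint_commute : Commute (adjoint V) U

/-- The joint wandering subspace `ker V* ∩ ker U*`. -/
def wanderingSubspace (V U : K →L[𝕜] K) : Submodule 𝕜 K := (adjoint V).ker ⊓ (adjoint U).ker

namespace IsDoublyCommutingPair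

lemma inner_pow_apply_pow_apply (h : IsDoublyCommutingPair V U) {x y : K}
    (hx : x ∈ wanderingSubspace V U) (hy : y ∈ wanderingSubspace V U) (m n : ℕ × ℕ) :
    inner 𝕜 ((V ^ m.1) ((U ^ m.2) x)) ((V ^ n.1) ((U ^ n.2) y)) =
      if m = n then inner 𝕜 x y else 0 := by
  rw [Hartogs.inner_pow_apply_pow_apply h.adjoint_mul_left
      (pow_apply_mem_ker h.adjoint_commute hx.1 _) (pow_apply_mem_ker h.adjoint_commute hy.1 _),
    Hartogs.inner_pow_apply_pow_apply h.adjoint_mul_right hx.2 hy.2, ← ite_and]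
  simp only [Prod.ext_iff]

lemma wanderingProj_mem_wanderingSubspace (h : IsDoublyCommutingPair V U) {x : K}
    (hx : adjoint V x = 0) : wanderingProj U x ∈ wanderingSubspace V U := by
  have hVU : Commute (adjoint V) (wanderingProj U) :=
    (Commute.one_right _).sub_right (h.adjoint_commute.mul_right h.commute.star_star)
  refine ⟨?_, adjoint_wanderingProj h.adjoint_mul_right x⟩
  exact pow_one (wanderingProj U) ▸ pow_apply_mem_ker hVU hx 1

/-- Słociński's Wold decomposition: the translates of the joint wandering subspace span a dense
subspace. -/
theorem eq_zero_of_inner_wandering (h : IsDoublyCommutingPair V U) (hV : IsPure V) (hU : IsPure U)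
    {x : K} (hx : ∀ u ∈ wanderingSubspace V U, ∀ n : ℕ × ℕ,
      inner 𝕜 ((V ^ n.1) ((U ^ n.2) u)) x = 0) : x = 0 := by
  refine hV.eq_zero_of_wanderingProj fun i => hU.eq_zero_of_wanderingProj fun j => ?_
  set e := wanderingProj V ((adjoint V ^ i) x)
  have he : adjoint V e = 0 := adjoint_wanderingProj h.adjoint_mul_left _
  have he' : adjoint V ((adjoint U ^ j) e) = 0 := pow_apply_mem_ker h.commute.star_star he j
  set u := wanderingProj U ((adjoint U ^ j) e)
  have hu : u ∈ wanderingSubspace V U := h.wanderingProj_mem_wanderingSubspace he'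
  have adjoint_pow (A : K →L[𝕜] K) (n : ℕ) : adjoint A ^ n = adjoint (A ^ n) := (star_pow A n).symm
  refine (inner_self_eq_zero (𝕜 := 𝕜)).1 ?_
  calc inner 𝕜 u u = inner 𝕜 u ((adjoint U ^ j) e) := inner_wanderingProj hu.2 _
    _ = inner 𝕜 ((U ^ j) u) e := by rw [adjoint_pow, adjoint_inner_right]
    _ = inner 𝕜 ((U ^ j) u) ((adjoint V ^ i) x) :=
      inner_wanderingProj (pow_apply_mem_ker h.adjoint_commute hu.1 j) _
    _ = inner 𝕜 ((V ^ i) ((U ^ j) u)) x := by rw [adjoint_pow, adjoint_inner_right]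
    _ = 0 := hx u hu (i, j)

end IsDoublyCommutingPair

lemma adjoint_shift_apply_succ {ι : Type*} (b : HilbertBasis (ℕ × ι) 𝕜 K)
    (hV : ∀ n k, V (b (n, k)) = b (n + 1, k)) (n : ℕ) (k : ι) :
    adjoint V (b (n + 1, k)) = b (n, k) := by
  classical
  refine b.repr.injective (lp.ext (funext fun m => ?_))
  rw [b.repr_apply_apply, b.repr_apply_apply, adjoint_inner_right, hV,
    orthonormal_iff_ite.1 b.orthonormal, orthonormal_iff_ite.1 b.orthonormal]
  simp only [Prod.ext_iff, add_left_inj]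

lemma adjoint_shift_apply_zero {ι : Type*} (b : HilbertBasis (ℕ × ι) 𝕜 K)
    (hV : ∀ n k, V (b (n, k)) = b (n + 1, k)) (k : ι) : adjoint V (b (0, k)) = 0 := by
  refine b.repr.injective (lp.ext (funext fun m => ?_))
  rw [b.repr_apply_apply, adjoint_inner_right, hV, b.orthonormal.inner_eq_zero (by simp), map_zero,
    lp.coeFn_zero, Pi.zero_apply]

theorem commute_adjoint_shift {ι : Type*} (b : HilbertBasis (ℕ × ι) 𝕜 K)
    (hV : ∀ n k, V (b (n, k)) = b (n + 1, k)) (τ : ι → ι) (hU : ∀ n k, U (b (n, k)) = b (n, τ k)) :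
    Commute (adjoint V) U := by
  have hb : Dense (Submodule.span 𝕜 (range b) : Set K) :=
    (Submodule.dense_iff_topologicalClosure_eq_top).2 b.dense_span
  refine ContinuousLinearMap.ext_on hb ?_
  rintro _ ⟨⟨n, k⟩, rfl⟩
  rw [mul_apply_eq_comp, mul_apply_eq_comp, hU]
  cases n with
  | zero => rw [adjoint_shift_apply_zero b hV, adjoint_shift_apply_zero b hV, map_zero]
  | succ n => rw [adjoint_shift_apply_succ b hV, adjoint_shift_apply_succ b hV, hU]

lemma mem_closure_span_iff_exists_hasSum {ι : Type*} {v : ι → K} (hv : Orthonormal 𝕜 v) {x : K} :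
    x ∈ (Submodule.span 𝕜 (range v)).topologicalClosure ↔
      ∃ a : lp (fun _ : ι => 𝕜) 2, HasSum (fun i => a i • v i) x := by
  have hspan : Submodule.span 𝕜 (range v) =
      ⨆ i, (LinearIsometry.toSpanSingleton 𝕜 K (hv.1 i)).toLinearMap.range := by
    rw [Submodule.span_range_eq_iSup]
    exact iSup_congr fun i => (LinearMap.range_toSpanSingleton (v i)).symm
  rw [hspan, ← hv.orthogonalFamily.range_linearIsometry]
  have hsum := hv.orthogonalFamily.hasSum_linearIsometry
  exact ⟨fun ⟨a, ha⟩ => ⟨a, ha ▸ hsum a⟩, fun ⟨a, ha⟩ => ⟨a, (hsum a).unique ha⟩⟩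

end Isometry

/-! ### Fourier series on the torus -/

section Fourier

open UnitAddTorus (mFourier mFourierCoeff mFourierBasis mFourierSubalgebra)

variable {d : Type*} [Fintype d]

/-- The normalized Haar measure on the torus of dimension `d`; for `d = Fin 2` it unfolds to
`torusMeasure`. -/
abbrev haarTorus (d : Type*) [Fintype d] : Measure (UnitAddTorus d) :=
  Measure.pi fun _ => AddCircle.haarAddCircle

/-- The monomials as a Hilbert basis of `L²`: Mathlib's `mFourierBasis`, whose measure is a local
instance there, with the measure spelled out. -/
def fourierBasis (d : Type*) [Fintype d] : HilbertBasis (d → ℤ) ℂ (Lp ℂ 2 (haarTorus d)) :=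
  mFourierBasis

lemma mFourierCoeff_def (F : UnitAddTorus d → ℂ) (α : d → ℤ) :
    mFourierCoeff F α = ∫ x, mFourier (-α) x * F x ∂haarTorus d := rfl

lemma fourierBasis_repr (F : Lp ℂ 2 (haarTorus d)) (α : d → ℤ) :
    (fourierBasis d).repr F α = mFourierCoeff F α := UnitAddTorus.mFourierBasis_repr F α

lemma norm_mFourier_apply (α : d → ℤ) (x : UnitAddTorus d) : ‖mFourier α x‖ = 1 := by
  simp only [mFourier, ContinuousMap.coe_mk, norm_prod, fourier_apply, Circle.norm_coe,
    Finset.prod_const_one]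

lemma fourierBasis_repr_toLp {F : UnitAddTorus d → ℂ} (hF : MemLp F 2 (haarTorus d)) (α : d → ℤ) :
    (fourierBasis d).repr (hF.toLp F) α = mFourierCoeff F α := by
  rw [fourierBasis_repr, mFourierCoeff_def, mFourierCoeff_def]
  exact integral_congr_ae (hF.coeFn_toLp.mono fun x hx => congrArg _ hx)

lemma ae_eq_of_mFourierCoeff_eq {F G : UnitAddTorus d → ℂ} (hF : MemLp F 2 (haarTorus d))
    (hG : MemLp G 2 (haarTorus d)) (h : mFourierCoeff F = mFourierCoeff G) :
    F =ᵐ[haarTorus d] G := by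
  refine (MemLp.toLp_eq_toLp_iff hF hG).1 ((fourierBasis d).repr.injective (lp.ext ?_))
  funext α
  rw [fourierBasis_repr_toLp, fourierBasis_repr_toLp, h]

lemma eLpNorm_sub_eq_tsum {F G : UnitAddTorus d → ℂ} (hF : MemLp F 2 (haarTorus d))
    (hG : MemLp G 2 (haarTorus d)) :
    eLpNorm (fun x => F x - G x) 2 (haarTorus d) =
      ENNReal.ofReal (√(∑' α, ‖mFourierCoeff F α - mFourierCoeff G α‖ ^ 2)) := by
  have h : ‖hF.toLp F - hG.toLp G‖ ^ 2 = ∑' α, ‖mFourierCoeff F α - mFourierCoeff G α‖ ^ 2 := by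
    rw [← (fourierBasis d).repr.norm_map, map_sub]
    have := lp.norm_rpow_eq_tsum (p := 2) (by norm_num)
      ((fourierBasis d).repr (hF.toLp F) - (fourierBasis d).repr (hG.toLp G))
    simpa [fourierBasis_repr_toLp] using this
  rw [← h, Real.sqrt_sq (norm_nonneg _), ← MemLp.toLp_sub, Lp.norm_toLp,
    ENNReal.ofReal_toReal (hF.sub hG).eLpNorm_ne_top]
  rfl

lemma mFourierCoeff_mFourier_mul (F : UnitAddTorus d → ℂ) (β α : d → ℤ) :
    mFourierCoeff (fun x => mFourier β x * F x) α = mFourierCoeff F (α - β) := by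
  simp only [mFourierCoeff_def, ← mul_assoc, ← UnitAddTorus.mFourier_add, neg_sub,
    neg_add_eq_sub]

lemma memLp_mFourier_mul {F : UnitAddTorus d → ℂ} (hF : MemLp F 2 (haarTorus d)) (β : d → ℤ) :
    MemLp (fun x => mFourier β x * F x) 2 (haarTorus d) := by
  refine hF.of_le ((mFourier β).continuous.aestronglyMeasurable.mul hF.1) ?_
  exact .of_forall fun x => by rw [norm_mul, norm_mFourier_apply, one_mul]

lemma integral_mFourier (α : d → ℤ) :
    ∫ x, mFourier α x ∂haarTorus d = if α = 0 then 1 else 0 := by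
  classical
  have h : fourierBasis d α = UnitAddTorus.mFourierLp 2 α :=
    congrFun UnitAddTorus.coe_mFourierBasis α
  calc ∫ x, mFourier α x ∂haarTorus d = mFourierCoeff (mFourier α) 0 := by
        simp only [mFourierCoeff_def, neg_zero, UnitAddTorus.mFourier_zero,
          ContinuousMap.one_apply, one_mul]
    _ = mFourierCoeff (UnitAddTorus.mFourierLp 2 α) 0 :=
        (UnitAddTorus.mFourierCoeff_toLp (mFourier α) 0).symm
    _ = (fourierBasis d).repr (fourierBasis d α) 0 := by rw [h]; exact (fourierBasis_repr _ 0).symm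
    _ = if α = 0 then 1 else 0 := by
        rw [HilbertBasis.repr_self, lp.single_apply, Pi.single_apply]
        simp only [eq_comm]

lemma measure_eq_of_integral_mFourier_eq {μ ν : Measure (UnitAddTorus d)} [IsFiniteMeasure μ]
    [IsFiniteMeasure ν] (h : ∀ α, ∫ x, mFourier α x ∂μ = ∫ x, mFourier α x ∂ν) : μ = ν := by
  have hint (κ : Measure (UnitAddTorus d)) [IsFiniteMeasure κ] (φ : C(UnitAddTorus d, ℂ)) :
      Integrable φ κ :=
    φ.continuous.integrable_of_hasCompactSupport (HasCompactSupport.of_compactSpace _)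
  have hspan (φ : C(UnitAddTorus d, ℂ)) (hφ : φ ∈ Submodule.span ℂ (range mFourier)) :
      ∫ x, φ x ∂μ = ∫ x, φ x ∂ν := by
    induction hφ using Submodule.span_induction with
    | mem φ hφ => obtain ⟨α, rfl⟩ := hφ; exact h α
    | zero => simp
    | add φ ψ _ _ hφ hψ =>
      simp only [ContinuousMap.add_apply, integral_add (hint _ _) (hint _ _), hφ, hψ]
    | smul c φ _ hφ => simp only [ContinuousMap.smul_apply, integral_smul, hφ]
  let A := (mFourierSubalgebra d).comap (BoundedContinuousFunction.toContinuousMapStarₐ ℂ)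
  refine ext_of_forall_mem_subalgebra_integral_eq_of_polish (𝕜 := ℂ) (A := A) ?_ fun φ hφ => ?_
  · rintro x y hxy
    obtain ⟨_, ⟨φ, hφ, rfl⟩, hne⟩ := UnitAddTorus.mFourierSubalgebra_separatesPoints hxy
    exact ⟨φ, ⟨φ, ⟨BoundedContinuousFunction.mkOfCompact φ, hφ, rfl⟩, rfl⟩, hne⟩
  · refine hspan φ.toContinuousMap ?_
    rw [← UnitAddTorus.mFourierSubalgebra_coe]
    exact hφ

lemma integral_withDensity_enorm_sq {X : Type*} [MeasurableSpace X] {μ : Measure X} {F : X → ℂ}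
    (hF : AEStronglyMeasurable F μ) (φ : X → ℂ) :
    ∫ x, φ x ∂μ.withDensity (fun x => ‖F x‖ₑ ^ 2) = ∫ x, φ x * (conj (F x) * F x) ∂μ := by
  rw [integral_withDensity_eq_integral_toReal_smul₀ (hF.enorm.pow_const 2)
    (.of_forall fun x => by simp)]
  congr 1 with x
  rw [Complex.conj_mul', ENNReal.toReal_pow, toReal_enorm, Complex.real_smul, mul_comm,
    Complex.ofReal_pow]

theorem ae_norm_eq_one_of_integral_mFourier_mul {F : UnitAddTorus d → ℂ}
    (hF : MemLp F 2 (haarTorus d))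
    (h : ∀ α, ∫ x, mFourier α x * (conj (F x) * F x) ∂haarTorus d = if α = 0 then 1 else 0) :
    ∀ᵐ x ∂haarTorus d, ‖F x‖ = 1 := by
  have hfin : ∫⁻ x, ‖F x‖ₑ ^ 2 ∂haarTorus d ≠ ∞ := by
    simpa using (lintegral_rpow_enorm_lt_top_of_eLpNorm_lt_top two_ne_zero ENNReal.ofNat_ne_top
      hF.2).ne
  have := isFiniteMeasure_withDensity hfin
  have hν : (haarTorus d).withDensity (fun x => ‖F x‖ₑ ^ 2) = haarTorus d :=
    measure_eq_of_integral_mFourier_eq fun α => by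
      rw [integral_withDensity_enorm_sq hF.1, h, integral_mFourier]
  have hone : (fun x => ‖F x‖ₑ ^ 2) =ᵐ[haarTorus d] fun _ => 1 := by
    rw [← withDensity_eq_iff (hF.1.enorm.pow_const 2) aemeasurable_const hfin, hν,
      withDensity_const, one_smul]
  filter_upwards [hone] with x hx
  have hx' : ‖F x‖ ^ 2 = 1 := by rw [← toReal_enorm, ← ENNReal.toReal_pow, hx, ENNReal.toReal_one]
  exact (pow_eq_one_iff_of_nonneg (norm_nonneg _) two_ne_zero).1 hx'

end Fourier

/-! ### Boundary functions -/

open UnitAddTorus (mFourier mFourierCoeff)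

/-- The ratio of the monomial `z ^ α 0 * w ^ α 1` on the torus `|z| = st`, `|w| = t` to the
character `mFourier α`. -/
def radialFactor (α : Fin 2 → ℤ) (s t : ℝ) : ℂ := (s : ℂ) ^ α 0 * (t : ℂ) ^ (α 0 + α 1)

lemma radialFactor_ne_zero (α : Fin 2 → ℤ) {s t : ℝ} (hs : s ∈ Ioo (0 : ℝ) 1)
    (ht : t ∈ Ioo (0 : ℝ) 1) : radialFactor α s t ≠ 0 :=
  mul_ne_zero (zpow_ne_zero _ (Complex.ofReal_ne_zero.2 hs.1.ne'))
    (zpow_ne_zero _ (Complex.ofReal_ne_zero.2 ht.1.ne'))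

lemma radialFactor_add (α β : Fin 2 → ℤ) {s t : ℝ} (hs : s ≠ 0) (ht : t ≠ 0) :
    radialFactor (α + β) s t = radialFactor α s t * radialFactor β s t := by
  simp only [radialFactor, Pi.add_apply, add_add_add_comm (α 0) (β 0),
    zpow_add₀ (Complex.ofReal_ne_zero.2 hs), zpow_add₀ (Complex.ofReal_ne_zero.2 ht)]
  ring

lemma tendsto_radialFactor (α : Fin 2 → ℤ) :
    Tendsto (fun p : ℝ × ℝ => radialFactor α p.1 p.2) toOne (𝓝 1) := by
  have hcont : ContinuousAt (fun p : ℝ × ℝ => radialFactor α p.1 p.2) (1, 1) :=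
    (ContinuousAt.zpow₀ (by fun_prop) _ (.inl (by simp))).mul
      (ContinuousAt.zpow₀ (by fun_prop) _ (.inl (by simp)))
  have hone : radialFactor α 1 1 = 1 := by simp [radialFactor]
  have htoOne : toOne ≤ 𝓝 (1, 1) := by
    rw [nhds_prod_eq]
    exact Filter.prod_mono nhdsWithin_le_nhds nhdsWithin_le_nhds
  simpa only [hone] using hcont.tendsto.mono_left htoOne

lemma norm_radialFactor_le {α : Fin 2 → ℤ} (hα : α ∈ indexSet) {s t : ℝ}
    (hs : s ∈ Ioo (0 : ℝ) 1) (ht : t ∈ Ioo (0 : ℝ) 1) : ‖radialFactor α s t‖ ≤ t⁻¹ := by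
  have hs' : s ^ α 0 ≤ 1 := zpow_le_one₀ hs.1 hs.2.le hα.1
  have ht' : t ^ (α 0 + α 1 + 1) ≤ 1 := zpow_le_one₀ ht.1 ht.2.le hα.2
  calc ‖radialFactor α s t‖ = s ^ α 0 * t ^ (α 0 + α 1) := by
        rw [radialFactor, norm_mul, norm_zpow, norm_zpow, Complex.norm_of_nonneg hs.1.le,
          Complex.norm_of_nonneg ht.1.le]
    _ ≤ 1 * t ^ (α 0 + α 1) := mul_le_mul_of_nonneg_right hs' (zpow_nonneg ht.1.le _)
    _ = t ^ (α 0 + α 1 + 1) * t⁻¹ := by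
        rw [one_mul, zpow_add_one₀ ht.1.ne', mul_inv_cancel_right₀ ht.1.ne']
    _ ≤ t⁻¹ := mul_le_of_le_one_left (inv_nonneg.2 ht.1.le) ht'

lemma mFourierCoeff_slice_eq_radialFactor_mul {f : triangle → ℂ} (hf : IsHolomorphic f)
    (α : Fin 2 → ℤ) {s t : ℝ} (hs : s ∈ Ioo (0 : ℝ) 1) (ht : t ∈ Ioo (0 : ℝ) 1) :
    mFourierCoeff (slice f s t) α = radialFactor α s t * coeff f α := by
  rw [mFourierCoeff_slice hf α hs ht, radialFactor, mul_assoc, mul_comm]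

lemma coeff_eq_of_mFourierCoeff_slice {f : triangle → ℂ} (hf : IsHolomorphic f) {α : Fin 2 → ℤ}
    {c : ℂ} (h : ∀ s ∈ Ioo (0 : ℝ) 1, ∀ t ∈ Ioo (0 : ℝ) 1,
      mFourierCoeff (slice f s t) α = radialFactor α s t * c) : coeff f α = c := by
  have hr : (2⁻¹ : ℝ) ∈ Ioo (0 : ℝ) 1 := by constructor <;> norm_num
  refine mul_left_cancel₀ (radialFactor_ne_zero α hr hr) ?_
  rw [← mFourierCoeff_slice_eq_radialFactor_mul hf α hr hr, h _ hr _ hr]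

lemma memLp_slice {f : triangle → ℂ} (hf : IsHolomorphic f) {s t : ℝ} (hs : s ∈ Ioo (0 : ℝ) 1)
    (ht : t ∈ Ioo (0 : ℝ) 1) : MemLp (slice f s t) 2 torusMeasure :=
  (continuous_slice hf hs ht).memLp_of_hasCompactSupport (HasCompactSupport.of_compactSpace _)

/-- The boundary function of a function in the Hardy space: the function on the torus that has the
Laurent coefficients as its Fourier coefficients. -/
def boundary : HardySpace →ₗᵢ[ℂ] Lp ℂ 2 torusMeasure :=
  (fourierBasis (Fin 2)).repr.symm.toLinearIsometry.comp ⟨coeffMap, norm_coeffMap⟩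

lemma mFourierCoeff_boundary (f : HardySpace) (α : Fin 2 → ℤ) :
    mFourierCoeff (boundary f) α = coeff f α := by
  rw [← fourierBasis_repr]
  exact congrFun (congrArg Subtype.val
    ((fourierBasis (Fin 2)).repr.apply_symm_apply (coeffMap f))) α

lemma inner_eq_integral_boundary (f g : HardySpace) :
    inner ℂ f g = ∫ x, conj (boundary f x) * boundary g x ∂torusMeasure := by
  rw [← boundary.inner_map_map, L2.inner_def]
  simp only [RCLike.inner_apply']

lemma tendsto_tsum_mFourierCoeff_slice_sub (f : HardySpace) :
    Tendsto (fun p : ℝ × ℝ => ∑' α, ‖mFourierCoeff (slice f p.1 p.2) α - coeff f α‖ ^ 2) toOne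
      (𝓝 0) := by
  have hhalf : ∀ᶠ p in toOne, 2⁻¹ ≤ p.2 := by
    have h : ∀ᶠ t in 𝓝[<] (1 : ℝ), 2⁻¹ ≤ t :=
      nhdsWithin_le_nhds (eventually_ge_nhds (by norm_num))
    exact h.prod_inr _
  rw [← tsum_zero (α := ℝ) (β := Fin 2 → ℤ)]
  refine tendsto_tsum_of_dominated_convergence ((summable_coeff f.coe_mem).mul_left (3 ^ 2))
    (fun α => ?_) ?_
  · have h := (((tendsto_radialFactor α).mul_const (coeff f α)).sub_const (coeff f α)).norm.pow 2
    rw [one_mul, sub_self, norm_zero, zero_pow two_ne_zero] at h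
    refine h.congr' (eventually_toOne.mono fun p hp => ?_)
    simp only [mFourierCoeff_slice_eq_radialFactor_mul f.coe_mem.1 α hp.1 hp.2]
  · filter_upwards [eventually_toOne, hhalf] with p hp hp' α
    rw [mFourierCoeff_slice_eq_radialFactor_mul f.coe_mem.1 α hp.1 hp.2, norm_pow, norm_norm,
      ← mul_pow]
    refine pow_le_pow_left₀ (norm_nonneg _) ?_ 2
    by_cases hα : α ∈ indexSet
    · have hfactor : ‖radialFactor α p.1 p.2‖ ≤ 2 :=
        (norm_radialFactor_le hα hp.1 hp.2).trans (inv_le_of_inv_le₀ two_pos hp')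
      calc ‖radialFactor α p.1 p.2 * coeff f α - coeff f α‖
          ≤ ‖radialFactor α p.1 p.2‖ * ‖coeff f α‖ + ‖coeff f α‖ :=
            (norm_sub_le _ _).trans_eq (by rw [norm_mul])
        _ ≤ 2 * ‖coeff f α‖ + ‖coeff f α‖ := by gcongr
        _ = 3 * ‖coeff f α‖ := by ring
    · simp [coeff_eq_zero f.coe_mem hα]

theorem isBoundaryFunction_boundary (f : HardySpace) : IsBoundaryFunction f (boundary f) := by
  refine ⟨Lp.memLp _, ?_⟩
  have h : Tendsto (fun p : ℝ × ℝ => ENNReal.ofReal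
      (√(∑' α, ‖mFourierCoeff (slice f p.1 p.2) α - coeff f α‖ ^ 2))) toOne (𝓝 0) := by
    simpa only [Real.sqrt_zero, ENNReal.ofReal_zero] using
      ENNReal.tendsto_ofReal (tendsto_tsum_mFourierCoeff_slice_sub f).sqrt
  refine h.congr' (eventually_toOne.mono fun p hp => ?_)
  simp only [eLpNorm_sub_eq_tsum (memLp_slice f.coe_mem.1 hp.1 hp.2) (Lp.memLp (boundary f)),
    mFourierCoeff_boundary]

lemma IsBoundaryFunction.ae_eq {f : triangle → ℂ} (hf : IsHolomorphic f) {F G : Torus → ℂ}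
    (hF : IsBoundaryFunction f F) (hG : IsBoundaryFunction f G) : F =ᵐ[torusMeasure] G := by
  have hle : eLpNorm (F - G) 2 torusMeasure ≤ 0 := by
    have hlim := hG.2.add hF.2
    rw [add_zero] at hlim
    refine ge_of_tendsto hlim (eventually_toOne.mono fun p hp => ?_)
    have hslice := (memLp_slice hf hp.1 hp.2).1
    have hFG : F - G =
        (fun x => slice f p.1 p.2 x - G x) - fun x => slice f p.1 p.2 x - F x := by
      ext x
      exact (sub_sub_sub_cancel_left _ _ _).symm
    rw [hFG]
    exact eLpNorm_sub_le (hslice.sub hG.1.1) (hslice.sub hF.1.1) one_le_two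
  have hzero := (eLpNorm_eq_zero_iff (hF.1.1.sub hG.1.1) two_ne_zero).1 (nonpos_iff_eq_zero.1 hle)
  exact hzero.mono fun x hx => sub_eq_zero.1 hx

lemma isUnimodular_iff (f : HardySpace) :
    IsUnimodular f ↔ ∀ᵐ x ∂torusMeasure, ‖boundary f x‖ = 1 := by
  refine ⟨fun ⟨F, hF, hone⟩ => ?_, fun h => ⟨_, isBoundaryFunction_boundary f, h⟩⟩
  filter_upwards [hone, hF.ae_eq f.coe_mem.1 (isBoundaryFunction_boundary f)] with x hx hFx
  rw [← hFx, hx]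

/-! ### Multiplication by monomials -/

/-- The exponents of `z ^ i * w ^ j`. -/
def expo (n : ℕ × ℕ) : Fin 2 → ℤ := ![n.1, n.2]

lemma expo_injective : Function.Injective expo := by
  intro m n h
  exact Prod.ext (Nat.cast_injective (congrFun h 0)) (Nat.cast_injective (congrFun h 1))

lemma exists_expo_sub (α : Fin 2 → ℤ) : ∃ m n : ℕ × ℕ, α = expo n - expo m := by
  refine ⟨((-α 0).toNat, (-α 1).toNat), ((α 0).toNat, (α 1).toNat), ?_⟩
  ext i
  fin_cases i <;> simp [expo]

lemma monomial_eq_radialFactor_mul (n : ℕ × ℕ) {t : ℝ} (ht : t ≠ 0) (s : ℝ) (x : Torus) :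
    ((s : ℂ) * t * (x 0).toCircle) ^ n.1 * ((t : ℂ) * (x 1).toCircle) ^ n.2 =
      radialFactor (expo n) s t * mFourier (expo n) x := by
  have hx : mFourier (expo n) x = ((x 0).toCircle : ℂ) ^ n.1 * ((x 1).toCircle : ℂ) ^ n.2 := by
    simp [mFourier, expo, fourier_apply, AddCircle.toCircle_zsmul]
  rw [hx, radialFactor, zpow_add₀ (Complex.ofReal_ne_zero.2 ht)]
  simp only [expo, Matrix.cons_val_zero, Matrix.cons_val_one, zpow_natCast]
  ring

/-- Multiplication by `z ^ i * w ^ j`. -/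
def monomialMul (n : ℕ × ℕ) : HardySpace →L[ℂ] HardySpace := Mz ^ n.1 * Mw ^ n.2

lemma Mz_pow_apply (i : ℕ) (f : HardySpace) (p : triangle) : (Mz ^ i) f p = p.1.1 ^ i * f p := by
  induction i with
  | zero => simp
  | succ i ih => rw [pow_succ', mul_apply_eq_comp, Mz_apply, ih, pow_succ', mul_assoc]

lemma Mw_pow_apply (i : ℕ) (f : HardySpace) (p : triangle) : (Mw ^ i) f p = p.1.2 ^ i * f p := by
  induction i with
  | zero => simp
  | succ i ih => rw [pow_succ', mul_apply_eq_comp, Mw_apply, ih, pow_succ', mul_assoc]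

lemma monomialMul_apply (n : ℕ × ℕ) (f : HardySpace) (p : triangle) :
    monomialMul n f p = p.1.1 ^ n.1 * p.1.2 ^ n.2 * f p := by
  rw [monomialMul, mul_apply_eq_comp, Mz_pow_apply, Mw_pow_apply, mul_assoc]

lemma monomialMul_fst (i : ℕ) : monomialMul (i, 0) = Mz ^ i := by
  rw [monomialMul, pow_zero, mul_one]

lemma monomialMul_snd (j : ℕ) : monomialMul (0, j) = Mw ^ j := by
  rw [monomialMul, pow_zero, one_mul]

lemma slice_monomialMul (n : ℕ × ℕ) (f : HardySpace) {s t : ℝ} (hs : s ∈ Ioo (0 : ℝ) 1)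
    (ht : t ∈ Ioo (0 : ℝ) 1) (x : Torus) :
    slice (monomialMul n f) s t x =
      radialFactor (expo n) s t * (mFourier (expo n) x * slice f s t x) := by
  rw [slice_apply _ hs ht, slice_apply _ hs ht, monomialMul_apply, ← mul_assoc,
    ← monomial_eq_radialFactor_mul n ht.1.ne']

lemma coeff_monomialMul (n : ℕ × ℕ) (f : HardySpace) (α : Fin 2 → ℤ) :
    coeff (monomialMul n f) α = coeff f (α - expo n) := by
  refine coeff_eq_of_mFourierCoeff_slice (monomialMul n f).coe_mem.1 fun s hs t ht => ?_
  calc mFourierCoeff (slice (monomialMul n f) s t) α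
      = radialFactor (expo n) s t *
          mFourierCoeff (fun x => mFourier (expo n) x * slice f s t x) α := by
        rw [mFourierCoeff_def, mFourierCoeff_def, ← integral_const_mul]
        congr 1 with x
        rw [slice_monomialMul n f hs ht, mul_left_comm]
    _ = radialFactor (expo n) s t * (radialFactor (α - expo n) s t * coeff f (α - expo n)) := by
        rw [mFourierCoeff_mFourier_mul,
          mFourierCoeff_slice_eq_radialFactor_mul f.coe_mem.1 _ hs ht]
    _ = radialFactor α s t * coeff f (α - expo n) := by
        rw [← mul_assoc, ← radialFactor_add _ _ hs.1.ne' ht.1.ne', add_sub_cancel]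

lemma boundary_monomialMul (n : ℕ × ℕ) (f : HardySpace) :
    boundary (monomialMul n f) =ᵐ[torusMeasure] fun x => mFourier (expo n) x * boundary f x := by
  refine ae_eq_of_mFourierCoeff_eq (Lp.memLp _) (memLp_mFourier_mul (Lp.memLp _) _)
    (funext fun α => ?_)
  rw [mFourierCoeff_mFourier_mul, mFourierCoeff_boundary, mFourierCoeff_boundary,
    coeff_monomialMul]

lemma inner_monomialMul (m n : ℕ × ℕ) (f g : HardySpace) :
    inner ℂ (monomialMul m f) (monomialMul n g) =
      ∫ x, mFourier (expo n - expo m) x * (conj (boundary f x) * boundary g x) ∂torusMeasure := by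
  rw [inner_eq_integral_boundary]
  refine integral_congr_ae ?_
  filter_upwards [boundary_monomialMul m f, boundary_monomialMul n g] with x hf hg
  rw [hf, hg, map_mul, sub_eq_add_neg, UnitAddTorus.mFourier_add, UnitAddTorus.mFourier_neg]
  ring

lemma norm_monomialMul (n : ℕ × ℕ) (f : HardySpace) : ‖monomialMul n f‖ = ‖f‖ := by
  have h : inner ℂ (monomialMul n f) (monomialMul n f) = inner ℂ f f := by
    rw [inner_monomialMul, inner_eq_integral_boundary]
    simp only [sub_self, UnitAddTorus.mFourier_zero, ContinuousMap.one_apply, one_mul]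
  rw [@norm_eq_sqrt_re_inner ℂ, h, ← @norm_eq_sqrt_re_inner ℂ]

lemma norm_Mz (f : HardySpace) : ‖Mz f‖ = ‖f‖ := by
  simpa only [monomialMul_fst, pow_one] using norm_monomialMul (1, 0) f

lemma norm_Mw (f : HardySpace) : ‖Mw f‖ = ‖f‖ := by
  simpa only [monomialMul_snd, pow_one] using norm_monomialMul (0, 1) f

lemma isPure_of_pow_eq_monomialMul {A : HardySpace →L[ℂ] HardySpace} {k : ℕ → ℕ × ℕ}
    (hA : ∀ n, A ^ n = monomialMul (k n)) (hk : ∀ α, ∃ n, α - expo (k n) ∉ indexSet) :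
    IsPure A := by
  refine (Submodule.eq_bot_iff _).2 fun x hx => coeffMap_injective (lp.ext (funext fun α => ?_))
  obtain ⟨n, hn⟩ := hk α
  obtain ⟨y, rfl⟩ := (Submodule.mem_iInf _).1 hx n
  rw [map_zero, coeffMap_apply]
  change coeff ((A ^ n) y) α = 0
  rw [hA, coeff_monomialMul, coeff_eq_zero y.coe_mem hn]

lemma isPure_Mz : IsPure Mz := by
  refine isPure_of_pow_eq_monomialMul (fun n => (monomialMul_fst n).symm) fun α => ?_
  refine ⟨(α 0).toNat + 1, fun h => ?_⟩
  have hnonneg : 0 ≤ α 0 - ↑((α 0).toNat + 1) := h.1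
  lia

lemma isPure_Mw : IsPure Mw := by
  refine isPure_of_pow_eq_monomialMul (fun n => (monomialMul_snd n).symm) fun α => ?_
  refine ⟨(α 0 + α 1 + 1).toNat + 1, fun h => ?_⟩
  have hnonneg : 0 ≤ (α 0 - (0 : ℕ)) + (α 1 - ↑((α 0 + α 1 + 1).toNat + 1)) + 1 := h.2
  lia

theorem isUnimodular_iff_orthonormal (q : HardySpace) :
    IsUnimodular q ↔ Orthonormal ℂ fun n => monomialMul n q := by
  simp only [isUnimodular_iff, orthonormal_iff_ite, inner_monomialMul]
  have hite (m n : ℕ × ℕ) :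
      (if expo n - expo m = 0 then 1 else 0 : ℂ) = if m = n then 1 else 0 := by
    simp only [sub_eq_zero, expo_injective.eq_iff, eq_comm]
  constructor
  · intro h m n
    rw [← hite, ← integral_mFourier (expo n - expo m)]
    refine integral_congr_ae ?_
    filter_upwards [h] with x hx
    rw [Complex.conj_mul', hx, Complex.ofReal_one, one_pow, mul_one]
  · intro h
    refine ae_norm_eq_one_of_integral_mFourier_mul (Lp.memLp _) fun α => ?_
    obtain ⟨m, n, rfl⟩ := exists_expo_sub α
    rw [h m n, hite]

theorem IsUnimodular.eq_zero_of_inner {q g : HardySpace} (hq : IsUnimodular q)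
    (h : ∀ m n, inner ℂ (monomialMul m q) (monomialMul n g) = 0) : g = 0 := by
  rw [isUnimodular_iff] at hq
  have hm : MemLp (fun x => conj (boundary q x) * boundary g x) 2 torusMeasure := by
    refine (Lp.memLp (boundary g)).of_le
      ((Complex.continuous_conj.comp_aestronglyMeasurable (Lp.memLp (boundary q)).1).mul
        (Lp.memLp (boundary g)).1) ?_
    filter_upwards [hq] with x hx
    rw [norm_mul, RCLike.norm_conj, hx, one_mul]
  have hzero : (fun x => conj (boundary q x) * boundary g x) =ᵐ[torusMeasure] 0 :=
    ae_eq_of_mFourierCoeff_eq hm MemLp.zero (funext fun α => by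
      obtain ⟨m, n, hα⟩ := exists_expo_sub (-α)
      rw [mFourierCoeff_def, hα, ← inner_monomialMul, h, mFourierCoeff_def]
      simp only [Pi.zero_apply, mul_zero, integral_zero])
  refine boundary.injective ?_
  rw [map_zero]
  refine Lp.eq_zero_iff_ae_eq_zero.2 ?_
  filter_upwards [hzero, hq] with x hx hqx
  have hne : boundary q x ≠ 0 := norm_ne_zero_iff.1 (by rw [hqx]; exact one_ne_zero)
  exact (mul_eq_zero.1 hx).resolve_left ((map_ne_zero _).2 hne)

/-! ### Power series in the Hardy space -/

lemma apply_eq_ofCoeff (f : HardySpace) (p : triangle) : f p = ofCoeff (coeff f) p := by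
  have h0 : ∀ α ∉ indexSet, coeffMap f α = 0 := fun α hα => coeff_eq_zero f.coe_mem hα
  have hf : f = (⟨ofCoeff (coeffMap f), ofCoeff_mem h0⟩ : HardySpace) :=
    coeffMap_injective (lp.ext (funext fun α =>
      (coeff_ofCoeff (lp.norm_apply_le_norm two_ne_zero _) h0 α).symm))
  exact DFunLike.congr_fun hf p

lemma norm_coeff_le (f : HardySpace) (α : Fin 2 → ℤ) : ‖coeff f α‖ ≤ ‖f‖ :=
  (lp.norm_apply_le_norm two_ne_zero (coeffMap f) α).trans_eq (norm_coeffMap f)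

lemma norm_apply_le (p : triangle) (f : HardySpace) :
    ‖f p‖ ≤ ‖p.1.2⁻¹‖ * (∑' n : ℕ × ℕ, ‖p.1.1 / p.1.2‖ ^ n.1 * ‖p.1.2‖ ^ n.2) * ‖f‖ := by
  have hw : 0 < ‖p.1.2‖ := (norm_nonneg _).trans_lt p.2.1
  have hu : ‖p.1.1 / p.1.2‖ < 1 := by rw [norm_div]; exact (div_lt_one hw).2 p.2.1
  have hs : Summable fun n : ℕ × ℕ => ‖p.1.1 / p.1.2‖ ^ n.1 * ‖p.1.2‖ ^ n.2 :=
    (summable_geometric_of_lt_one (norm_nonneg _) hu).mul_of_nonneg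
      (summable_geometric_of_lt_one (norm_nonneg _) p.2.2) (fun _ => by positivity)
      (fun _ => by positivity)
  rw [apply_eq_ofCoeff, ofCoeff, norm_mul, mul_assoc]
  refine mul_le_mul_of_nonneg_left ?_ (norm_nonneg _)
  refine tsum_of_norm_bounded (hs.hasSum.mul_right ‖f‖) fun n => ?_
  rw [norm_mul, norm_mul, norm_pow, norm_pow, mul_comm]
  exact mul_le_mul_of_nonneg_left (norm_coeff_le f _) (by positivity)

/-- Evaluation at a point of the triangle, as a continuous linear functional. -/
def evalAt (p : triangle) : HardySpace →L[ℂ] ℂ :=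
  LinearMap.mkContinuous
    { toFun := fun f => f p
      map_add' := fun _ _ => rfl
      map_smul' := fun _ _ => rfl }
    (‖p.1.2⁻¹‖ * ∑' n : ℕ × ℕ, ‖p.1.1 / p.1.2‖ ^ n.1 * ‖p.1.2‖ ^ n.2) (norm_apply_le p)

lemma hasSum_apply_of_hasSum {q f : HardySpace} {a : ℕ × ℕ → ℂ}
    (h : HasSum (fun n => a n • monomialMul n q) f) (p : triangle) :
    HasSum (fun n : ℕ × ℕ => q p * (a n * p.1.1 ^ n.1 * p.1.2 ^ n.2)) (f p) := by
  refine ((evalAt p).hasSum h).congr_fun fun n => ?_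
  rw [map_smul, smul_eq_mul]
  change _ = a n * monomialMul n q p
  rw [monomialMul_apply]
  ring

lemma coeff_eq_of_hasSum {f : HardySpace} {a : ℕ × ℕ → ℂ}
    (h : ∀ p : triangle, HasSum (fun n : ℕ × ℕ => a n * p.1.1 ^ n.1 * p.1.2 ^ n.2) (f p))
    (n : ℕ × ℕ) : coeff f (expo n) = a n := by
  refine coeff_eq_of_mFourierCoeff_slice f.coe_mem.1 fun s hs t ht => ?_
  let c : (Fin 2 → ℤ) → ℂ := Function.extend expo (fun n => radialFactor (expo n) s t * a n) 0
  have hc (n) : c (expo n) = radialFactor (expo n) s t * a n := expo_injective.extend_apply _ _ _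
  have hc0 (α) (hα : α ∉ range expo) : c α = 0 := Function.extend_apply' _ _ _ hα
  have hslice (x : Torus) : HasSum (fun α => c α * mFourier α x) (slice f s t x) := by
    rw [slice_apply _ hs ht, ← expo_injective.hasSum_iff fun α hα => by rw [hc0 α hα, zero_mul]]
    refine (h _).congr_fun fun n => ?_
    rw [Function.comp_apply, hc, mul_assoc (a n), monomial_eq_radialFactor_mul n ht.1.ne']
    ring
  have hsummable : Summable c := by
    simpa [mFourier] using (hslice 0).summable
  rw [mFourierCoeff_of_hasSum hsummable hslice, hc]

/-- The constant function one. -/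
def oneFun : HardySpace where
  val := fun _ => 1
  property := by
    refine ⟨isHolomorphic_of_differentiable (differentiable_const 1), 1, fun s hs t ht => ?_⟩
    have hslice (x : Torus) : ‖slice (fun _ => 1) s t x‖ ^ 2 * (s * t ^ 2) = s * t ^ 2 := by
      rw [slice_apply _ hs ht, norm_one, one_pow, one_mul]
    simp only [mean, hslice, integral_const, probReal_univ, one_smul]
    exact mul_le_one₀ hs.2.le (by positivity) (pow_le_one₀ ht.1.le ht.2.le)

lemma oneFun_apply (p : triangle) : oneFun p = 1 := rfl

lemma isUnimodular_oneFun : IsUnimodular oneFun := by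
  refine ⟨fun _ => 1, ⟨memLp_const 1, ?_⟩, .of_forall fun _ => norm_one⟩
  refine tendsto_const_nhds.congr' (eventually_toOne.mono fun p hp => ?_)
  have hslice : (fun x => slice oneFun p.1 p.2 x - 1) = 0 := by
    ext x
    rw [slice_apply _ hp.1 hp.2, oneFun_apply, sub_self, Pi.zero_apply]
  simp only [hslice, eLpNorm_zero]

/-- The closed subspace spanned by the products of `q` with the monomials `z ^ i * w ^ j`. -/
def cyclicSubspace (q : HardySpace) : Submodule ℂ HardySpace :=
  (Submodule.span ℂ (range fun n => monomialMul n q)).topologicalClosure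

lemma monomialMul_mem_cyclicSubspace (n : ℕ × ℕ) (q : HardySpace) :
    monomialMul n q ∈ cyclicSubspace q :=
  Submodule.le_topologicalClosure _ (Submodule.subset_span ⟨n, rfl⟩)

lemma self_mem_cyclicSubspace (q : HardySpace) : q ∈ cyclicSubspace q :=
  monomialMul_mem_cyclicSubspace (0, 0) q

lemma eq_zero_of_mem_cyclicSubspace {q x : HardySpace} (hx : x ∈ cyclicSubspace q)
    (h : ∀ n, inner ℂ (monomialMul n q) x = 0) : x = 0 := by
  have hspan : Submodule.span ℂ (range fun n => monomialMul n q) ≤ (ℂ ∙ x)ᗮ := by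
    rw [Submodule.span_le]
    rintro _ ⟨n, rfl⟩
    exact Submodule.mem_orthogonal_singleton_iff_inner_left.2 (h n)
  have hxx : x ∈ (ℂ ∙ x)ᗮ :=
    Submodule.topologicalClosure_minimal _ hspan (Submodule.isClosed_orthogonal _) hx
  exact inner_self_eq_zero.1 (Submodule.mem_orthogonal_singleton_iff_inner_left.1 hxx)

lemma IsUnimodular.mem_cyclicSubspace_iff {q : HardySpace} (hq : IsUnimodular q) {f : HardySpace} :
    f ∈ cyclicSubspace q ↔
      ∃ a : lp (fun _ : ℕ × ℕ => ℂ) 2, HasSum (fun n => a n • monomialMul n q) f :=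
  mem_closure_span_iff_exists_hasSum ((isUnimodular_iff_orthonormal q).1 hq)

lemma IsUnimodular.exists_hasSum {q : HardySpace} (hq : IsUnimodular q)
    (a : lp (fun _ : ℕ × ℕ => ℂ) 2) : ∃ f, HasSum (fun n => a n • monomialMul n q) f :=
  ⟨_, ((isUnimodular_iff_orthonormal q).1 hq).orthogonalFamily.hasSum_linearIsometry a⟩

theorem hardyPlus_eq_cyclicSubspace : hardyPlus = cyclicSubspace oneFun := by
  ext f
  rw [SetLike.mem_coe, isUnimodular_oneFun.mem_cyclicSubspace_iff]
  have happ {a : ℕ × ℕ → ℂ} {f : HardySpace} (h : HasSum (fun n => a n • monomialMul n oneFun) f)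
      (p : triangle) : HasSum (fun n : ℕ × ℕ => a n * p.1.1 ^ n.1 * p.1.2 ^ n.2) (f p) := by
    simpa only [oneFun_apply, one_mul] using hasSum_apply_of_hasSum h p
  constructor
  · rintro ⟨a, ha⟩
    have hsq : Summable fun n : ℕ × ℕ => ‖a n.1 n.2‖ ^ 2 :=
      ((summable_coeff f.coe_mem).comp_injective expo_injective).congr fun n => by
        rw [Function.comp_apply, coeff_eq_of_hasSum (a := fun n => a n.1 n.2) ha]
    let b : lp (fun _ : ℕ × ℕ => ℂ) 2 := ⟨fun n => a n.1 n.2, memℓp_gen (by simpa using hsq)⟩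
    obtain ⟨g, hg⟩ := isUnimodular_oneFun.exists_hasSum b
    exact ⟨b, DFunLike.ext g f (fun p => (happ hg p).unique (ha p)) ▸ hg⟩
  · rintro ⟨a, ha⟩
    exact ⟨fun i j => a (i, j), happ ha⟩

theorem image_mul_hardyPlus {q : HardySpace} (hq : IsUnimodular q) :
    (fun g : HardySpace => (q : triangle → ℂ) * (g : triangle → ℂ)) '' hardyPlus =
      (fun f : HardySpace => (f : triangle → ℂ)) '' cyclicSubspace q := by
  have hmul {a : ℕ × ℕ → ℂ} {f g : HardySpace} (hf : HasSum (fun n => a n • monomialMul n q) f)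
      (hg : HasSum (fun n => a n • monomialMul n oneFun) g) : (q : triangle → ℂ) * g = f := by
    ext p
    have h := (hasSum_apply_of_hasSum hg p).mul_left (q p)
    simp only [oneFun_apply, one_mul] at h
    exact h.unique (hasSum_apply_of_hasSum hf p)
  rw [hardyPlus_eq_cyclicSubspace]
  apply Subset.antisymm
  · rintro _ ⟨g, hg, rfl⟩
    obtain ⟨a, ha⟩ := isUnimodular_oneFun.mem_cyclicSubspace_iff.1 hg
    obtain ⟨f, hf⟩ := hq.exists_hasSum a
    exact ⟨f, hq.mem_cyclicSubspace_iff.2 ⟨a, hf⟩, (hmul hf ha).symm⟩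
  · rintro _ ⟨f, hf, rfl⟩
    obtain ⟨a, ha⟩ := hq.mem_cyclicSubspace_iff.1 hf
    obtain ⟨g, hg⟩ := isUnimodular_oneFun.exists_hasSum a
    exact ⟨g, isUnimodular_oneFun.mem_cyclicSubspace_iff.2 ⟨a, hg⟩, hmul ha hg⟩

/-! ### Submodules -/

namespace HardySubmodule

open ContinuousLinearMap (adjoint)

variable (S : HardySubmodule)

lemma coe_Sz_pow_Sw_pow (n : ℕ × ℕ) (x : S.toSubmodule) :
    ((S.Sz ^ n.1) ((S.Sw ^ n.2) x) : HardySpace) = monomialMul n x := by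
  rw [Sz, Sw, coe_restrict_pow_apply, coe_restrict_pow_apply, monomialMul, mul_apply_eq_comp]

lemma monomialMul_mem (n : ℕ × ℕ) {x : HardySpace} (hx : x ∈ S.toSubmodule) :
    monomialMul n x ∈ S.toSubmodule :=
  S.coe_Sz_pow_Sw_pow n ⟨x, hx⟩ ▸ Subtype.property _

lemma cyclicSubspace_le {q : HardySpace} (hq : q ∈ S.toSubmodule) :
    cyclicSubspace q ≤ S.toSubmodule := by
  refine Submodule.topologicalClosure_minimal _ (Submodule.span_le.2 ?_) S.isClosed'
  rintro _ ⟨n, rfl⟩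
  exact S.monomialMul_mem n hq

lemma isPure_Sz : IsPure S.Sz := isPure_Mz.restrict S.Mz_mem'

lemma isPure_Sw : IsPure S.Sw := isPure_Mw.restrict S.Mw_mem'

lemma adjoint_Sz_mul_Sz : adjoint S.Sz * S.Sz = 1 := by
  refine (ContinuousLinearMap.norm_map_iff_adjoint_comp_self S.Sz).1 fun x => ?_
  exact norm_Mz (x : HardySpace)

lemma adjoint_Sw_mul_Sw : adjoint S.Sw * S.Sw = 1 := by
  refine (ContinuousLinearMap.norm_map_iff_adjoint_comp_self S.Sw).1 fun x => ?_
  exact norm_Mw (x : HardySpace)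

lemma commute_Sz_Sw : Commute S.Sz S.Sw := by
  refine ContinuousLinearMap.ext fun x => Subtype.ext (DFunLike.ext _ _ fun p => ?_)
  exact mul_left_comm p.1.1 p.1.2 ((x : HardySpace) p)

variable {S}

lemma isDoublyCommuting_iff : S.IsDoublyCommuting ↔ Commute (adjoint S.Sz) S.Sw := by
  rw [IsDoublyCommuting, commute_iff_lie_eq]

namespace IsDoublyCommuting

variable (h : S.IsDoublyCommuting)
include h

lemma isDoublyCommutingPair : IsDoublyCommutingPair S.Sz S.Sw where
  adjoint_mul_left := S.adjoint_Sz_mul_Sz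
  adjoint_mul_right := S.adjoint_Sw_mul_Sw
  commute := S.commute_Sz_Sw
  adjoint_commute := isDoublyCommuting_iff.1 h

lemma inner_monomialMul_of_wandering {x y : S.toSubmodule}
    (hx : x ∈ wanderingSubspace S.Sz S.Sw) (hy : y ∈ wanderingSubspace S.Sz S.Sw) (m n : ℕ × ℕ) :
    inner ℂ (monomialMul m (x : HardySpace)) (monomialMul n (y : HardySpace)) =
      if m = n then inner ℂ x y else 0 := by
  rw [← coe_Sz_pow_Sw_pow, ← coe_Sz_pow_Sw_pow, ← Submodule.coe_inner,
    h.isDoublyCommutingPair.inner_pow_apply_pow_apply hx hy]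

lemma eq_zero_of_inner_monomialMul {x : S.toSubmodule}
    (hx : ∀ u ∈ wanderingSubspace S.Sz S.Sw, ∀ n,
      inner ℂ (monomialMul n (u : HardySpace)) (x : HardySpace) = 0) : x = 0 := by
  refine h.isDoublyCommutingPair.eq_zero_of_inner_wandering S.isPure_Sz S.isPure_Sw
    fun u hu n => ?_
  rw [Submodule.coe_inner, coe_Sz_pow_Sw_pow, hx u hu n]

lemma exists_unit_wandering (hS : S.toSubmodule ≠ ⊥) :
    ∃ q ∈ wanderingSubspace S.Sz S.Sw, ‖q‖ = 1 := by
  obtain ⟨x, hx, hx0⟩ := Submodule.exists_mem_ne_zero_of_ne_bot hS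
  obtain ⟨u, hu, hu0⟩ : ∃ u ∈ wanderingSubspace S.Sz S.Sw, u ≠ 0 := by
    by_contra! hW
    refine hx0 (congrArg Subtype.val
      (h.eq_zero_of_inner_monomialMul (x := ⟨x, hx⟩) fun u hu n => ?_))
    rw [hW u hu, Submodule.coe_zero, map_zero, inner_zero_left]
  exact ⟨_, Submodule.smul_mem _ _ hu, norm_smul_inv_norm (𝕜 := ℂ) hu0⟩

variable {q : S.toSubmodule} (hq : q ∈ wanderingSubspace S.Sz S.Sw) (hq1 : ‖q‖ = 1)
include hq hq1

lemma isUnimodular_of_wandering : IsUnimodular (q : HardySpace) := by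
  rw [isUnimodular_iff_orthonormal, orthonormal_iff_ite]
  intro m n
  rw [h.inner_monomialMul_of_wandering hq hq, inner_self_eq_one_of_norm_eq_one hq1]

lemma eq_inner_smul_of_wandering {v : S.toSubmodule} (hv : v ∈ wanderingSubspace S.Sz S.Sw) :
    v = inner ℂ q v • q := by
  have hvq : v - inner ℂ q v • q ∈ wanderingSubspace S.Sz S.Sw :=
    Submodule.sub_mem _ hv (Submodule.smul_mem _ _ hq)
  have hinner : inner ℂ q (v - inner ℂ q v • q) = 0 := by
    rw [inner_sub_right, inner_smul_right (E := S.toSubmodule),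
      inner_self_eq_one_of_norm_eq_one hq1, mul_one, sub_self]
  refine sub_eq_zero.1 (Subtype.ext ?_)
  refine (h.isUnimodular_of_wandering hq hq1).eq_zero_of_inner fun m n => ?_
  rw [h.inner_monomialMul_of_wandering hq hvq, hinner, ite_self]

lemma eq_cyclicSubspace : S.toSubmodule = cyclicSubspace (q : HardySpace) := by
  have hle : cyclicSubspace (q : HardySpace) ≤ S.toSubmodule := S.cyclicSubspace_le q.2
  have : CompleteSpace (cyclicSubspace (q : HardySpace)) :=
    Submodule.topologicalClosure.completeSpace _
  have hbot : (cyclicSubspace (q : HardySpace))ᗮ ⊓ S.toSubmodule = ⊥ := by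
    refine (Submodule.eq_bot_iff _).2 fun x ⟨hx, hxS⟩ => ?_
    refine congrArg Subtype.val (h.eq_zero_of_inner_monomialMul (x := ⟨x, hxS⟩) fun u hu n => ?_)
    rw [h.eq_inner_smul_of_wandering hq hq1 hu, Submodule.coe_smul, map_smul, inner_smul_left,
      (Submodule.mem_orthogonal _ _).1 hx _ (monomialMul_mem_cyclicSubspace n _), mul_zero]
  calc S.toSubmodule
      = cyclicSubspace (q : HardySpace) ⊔ (cyclicSubspace (q : HardySpace))ᗮ ⊓ S.toSubmodule :=
        (Submodule.sup_orthogonal_inf_of_hasOrthogonalProjection hle).symm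
    _ = cyclicSubspace (q : HardySpace) := by rw [hbot, sup_bot_eq]

end IsDoublyCommuting

lemma exists_hilbertBasis {q : HardySpace} (hq : IsUnimodular q)
    (hS : S.toSubmodule = cyclicSubspace q) :
    ∃ b : HilbertBasis (ℕ × ℕ) ℂ S.toSubmodule, ∀ n, (b n : HardySpace) = monomialMul n q := by
  let e (n : ℕ × ℕ) : S.toSubmodule := ⟨monomialMul n q, hS ▸ monomialMul_mem_cyclicSubspace n q⟩
  have he : Orthonormal ℂ e := by
    rw [orthonormal_iff_ite]
    exact orthonormal_iff_ite.1 ((isUnimodular_iff_orthonormal q).1 hq)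
  have hbot : (Submodule.span ℂ (range e))ᗮ = ⊥ := by
    refine (Submodule.eq_bot_iff _).2 fun x hx => ?_
    refine Subtype.ext (eq_zero_of_mem_cyclicSubspace (hS.le x.2) fun n => ?_)
    exact (Submodule.mem_orthogonal _ _).1 hx (e n) (Submodule.subset_span ⟨n, rfl⟩)
  refine ⟨HilbertBasis.mkOfOrthogonalEqBot he hbot, fun n => ?_⟩
  rw [HilbertBasis.coe_mkOfOrthogonalEqBot]

theorem isDoublyCommuting_of_eq_cyclicSubspace {q : HardySpace} (hq : IsUnimodular q)
    (hS : S.toSubmodule = cyclicSubspace q) : S.IsDoublyCommuting := by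
  obtain ⟨b, hb⟩ := exists_hilbertBasis hq hS
  refine isDoublyCommuting_iff.2 (commute_adjoint_shift b (fun i j => ?_) (· + 1) fun i j => ?_)
  · refine Subtype.ext (DFunLike.ext _ _ fun p => ?_)
    change p.1.1 * (b (i, j) : HardySpace) p = _
    rw [hb, hb, monomialMul_apply, monomialMul_apply, pow_succ]
    ring
  · refine Subtype.ext (DFunLike.ext _ _ fun p => ?_)
    change p.1.2 * (b (i, j) : HardySpace) p = _
    rw [hb, hb, monomialMul_apply, monomialMul_apply, pow_succ]
    ring

theorem isDoublyCommuting_iff_exists_eq_cyclicSubspace (hS : S.toSubmodule ≠ ⊥) :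
    S.IsDoublyCommuting ↔
      ∃ q : HardySpace, IsUnimodular q ∧ S.toSubmodule = cyclicSubspace q := by
  refine ⟨fun h => ?_, fun ⟨q, hq, h⟩ => isDoublyCommuting_of_eq_cyclicSubspace hq h⟩
  obtain ⟨q, hq, hq1⟩ := h.exists_unit_wandering hS
  exact ⟨q, h.isUnimodular_of_wandering hq hq1, h.eq_cyclicSubspace hq hq1⟩

end HardySubmodule

end Hartogs

end

theorem theorem1p1 (S : Hartogs.HardySubmodule) (hS : S.toSubmodule ≠ ⊥) :
    S.IsDoublyCommuting ↔
      ∃ q : Hartogs.triangle → ℂ, Hartogs.IsUnimodular q ∧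
        (fun f : Hartogs.HardySpace => (f : Hartogs.triangle → ℂ)) '' (S.toSubmodule : Set Hartogs.HardySpace) =
          (fun g : Hartogs.HardySpace => q * (g : Hartogs.triangle → ℂ)) '' Hartogs.hardyPlus := by
  rw [Hartogs.HardySubmodule.isDoublyCommuting_iff_exists_eq_cyclicSubspace hS]
  constructor
  · rintro ⟨q, hq, h⟩
    exact ⟨q, hq, by rw [Hartogs.image_mul_hardyPlus hq, h]⟩
  · rintro ⟨q, hq, h⟩
    obtain ⟨f, -, rfl⟩ : q ∈ (fun f : Hartogs.HardySpace => (f : Hartogs.triangle → ℂ)) ''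
        (S.toSubmodule : Set Hartogs.HardySpace) := by
      rw [h, Hartogs.hardyPlus_eq_cyclicSubspace]
      exact ⟨Hartogs.oneFun, Hartogs.self_mem_cyclicSubspace _, mul_one q⟩
    rw [Hartogs.image_mul_hardyPlus hq] at h
    exact ⟨f, hq, SetLike.coe_injective (DFunLike.coe_injective.image_injective h)⟩
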